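/- A \emph{lattice polygon} is a two-dimensional polytope $P\subset\mathbb R^2$ (the convex hull of a finite set of points, not contained in a line) all of whose vertices lie in $\mathbb Z^2$. It is \emph{smooth} if every vertex $v$ is adjacent to exactly two vertices $w_1,w_2$ and $$\det\left(\frac{w_1-v}{\gcd(w_1-v)},\ \frac{w_2-v}{\gcd(w_2-v)}\right)=\pm1,$$ where $w_i$ is adjacent to $v$ if the segment $[v,w_i]$ is an edge of $P$ and $\gcd(z)$ denotes the greatest common divisor of the coordinates of $z\in\mathbb Z^2$. Two lattice polygons are \emph{lattice-isomorphic} if one is mapped onto the other by a map $x\mapsto Ax+t$ with $A\in GL_2(\mathbb Z)$ and $t\in\mathbb Z^2$. \textbf{Proposition.} Up to lattice isomorphism there are exactly $41$ smooth lattice polygons $P$ with at most $12$ lattice points, i.e. with $|P\cap\mathbb Z^2|\le 12$. Up to lattice isomorphism, the number of those with a given number of vertices is $$\begin{array}{r|ccccccc}\text{vertices} & 3 & 4 & 5 & 6 & 7 & 8 & \ge 9\\\hline \text{polygons} & 3 & 30 & 3 & 4 & 0 & 1 & 0\end{array}$$ -/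

import Mathlib

namespace LatticePolytope

/-- The inclusion of the lattice `ℤ^d` into `ℝ^d`. -/
def toReal {d : ℕ} (z : Fin d → ℤ) : Fin d → ℝ := fun i => (z i : ℝ)

/-- A polytope in `ℝ^d` is the convex hull of a finite set of points. -/
def IsPolytope {d : ℕ} (P : Set (Fin d → ℝ)) : Prop :=
  ∃ S : Set (Fin d → ℝ), S.Finite ∧ P = convexHull ℝ S

/-- The dimension of `P` is the dimension `d` of the ambient space. -/
def IsFullDimensional {d : ℕ} (P : Set (Fin d → ℝ)) : Prop :=
  affineSpan ℝ P = ⊤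

/-- The vertices of a polytope are its extreme points. -/
def vertices {d : ℕ} (P : Set (Fin d → ℝ)) : Set (Fin d → ℝ) := P.extremePoints ℝ

/-- The lattice points of `P`, that is `P ∩ ℤ^d`. -/
def latticePoints {d : ℕ} (P : Set (Fin d → ℝ)) : Set (Fin d → ℤ) := {z | toReal z ∈ P}

/-- The vertices adjacent to `v`: those `w ≠ v` for which the segment from `v` to `w` is a face
(an edge) of `P`, a face being the set of maximizers over `P` of a linear functional. -/
def neighbors {d : ℕ} (P : Set (Fin d → ℝ)) (v : Fin d → ℝ) : Set (Fin d → ℝ) :=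
  {w | w ∈ vertices P ∧ w ≠ v ∧ IsExposed ℝ P (segment ℝ v w)}

/-- All vertices of `P` have integer coordinates. -/
def IsLattice {d : ℕ} (P : Set (Fin d → ℝ)) : Prop :=
  ∀ v ∈ vertices P, ∃ z : Fin d → ℤ, v = toReal z

/-- Every vertex of `P` is adjacent to exactly `d` vertices. -/
def IsSimple {d : ℕ} (P : Set (Fin d → ℝ)) : Prop :=
  ∀ v ∈ vertices P, (neighbors P v).encard = d

/-- The lattice vector `z` divided by the greatest common divisor of its coordinates. -/
def primitive {d : ℕ} (z : Fin d → ℤ) : Fin d → ℤ := fun i => z i / Finset.univ.gcd z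

/-- A smooth lattice `d`-polytope in `ℝ^d`: a full-dimensional simple lattice polytope such that,
at each vertex `v`, the primitive edge directions `(w - v) / gcd (w - v)`, where `w` runs through
the vertices adjacent to `v`, form a matrix of determinant `± 1`. The order of the rows affects
only the sign, so it does not matter which enumeration `w 0, …, w (d - 1)` of the neighbors is
used. -/
structure IsSmooth {d : ℕ} (P : Set (Fin d → ℝ)) : Prop where
  isPolytope : IsPolytope P
  isFullDimensional : IsFullDimensional P
  isLattice : IsLattice P
  isSimple : IsSimple P
  det_eq : ∀ v : Fin d → ℤ, toReal v ∈ vertices P →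
    ∃ w : Fin d → Fin d → ℤ, Function.Injective w ∧
      Set.range (fun i => toReal (w i)) = neighbors P (toReal v) ∧
      ((Matrix.of fun i => primitive (w i - v)).det = 1 ∨
        (Matrix.of fun i => primitive (w i - v)).det = -1)

/-- The affine map `x ↦ A x + t` of `ℝ^d` given by `A ∈ GL_d(ℤ)` and `t ∈ ℤ^d`. These maps are
the affine automorphisms of `ℝ^d` that preserve the lattice `ℤ^d`. -/
def latticeMap {d : ℕ} (A : GL (Fin d) ℤ) (t : Fin d → ℤ) (x : Fin d → ℝ) : Fin d → ℝ :=
  ((A : Matrix (Fin d) (Fin d) ℤ).map (Int.cast : ℤ → ℝ)).mulVec x + toReal t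

/-- Two subsets of `ℝ^d` are lattice-isomorphic if an affine automorphism of the lattice maps
one onto the other. -/
def LatticeIso {d : ℕ} (P Q : Set (Fin d → ℝ)) : Prop :=
  ∃ (A : GL (Fin d) ℤ) (t : Fin d → ℤ), latticeMap A t '' P = Q

theorem latticeMap_one_zero {d : ℕ} (x : Fin d → ℝ) :
    latticeMap (1 : GL (Fin d) ℤ) 0 x = x := by
  funext i
  simp [latticeMap, toReal, Matrix.map_one]

theorem toReal_mulVec {d : ℕ} (A : Matrix (Fin d) (Fin d) ℤ) (t : Fin d → ℤ) :
    toReal (A.mulVec t) = (A.map (Int.cast : ℤ → ℝ)).mulVec (toReal t) := by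
  funext i
  simp [toReal, Matrix.mulVec, dotProduct]

theorem latticeMap_latticeMap {d : ℕ} (A B : GL (Fin d) ℤ) (s t : Fin d → ℤ)
    (x : Fin d → ℝ) :
    latticeMap B t (latticeMap A s x) =
      latticeMap (B * A) ((B : Matrix (Fin d) (Fin d) ℤ).mulVec s + t) x := by
  have h : ((B : Matrix (Fin d) (Fin d) ℤ) * (A : Matrix (Fin d) (Fin d) ℤ)).map
      (Int.cast : ℤ → ℝ) = (B : Matrix (Fin d) (Fin d) ℤ).map (Int.cast : ℤ → ℝ) *
        (A : Matrix (Fin d) (Fin d) ℤ).map (Int.cast : ℤ → ℝ) :=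
    Matrix.map_mul (f := Int.castRingHom ℝ)
  have h2 : toReal ((B : Matrix (Fin d) (Fin d) ℤ).mulVec s + t) =
      toReal ((B : Matrix (Fin d) (Fin d) ℤ).mulVec s) + toReal t := by
    funext i
    simp [toReal]
  simp only [latticeMap, Units.val_mul, h, h2, toReal_mulVec, Matrix.mulVec_add,
    Matrix.mulVec_mulVec, add_assoc]

/-- Lattice isomorphism is an equivalence relation on the subsets of `ℝ^d`. -/
def latticeSetoid (d : ℕ) : Setoid (Set (Fin d → ℝ)) where
  r := LatticeIso
  iseqv :=
    { refl := fun P => ⟨1, 0, by simp [latticeMap_one_zero]⟩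
      symm := by
        rintro P Q ⟨A, t, rfl⟩
        refine ⟨A⁻¹, -((A⁻¹ : GL (Fin d) ℤ) : Matrix (Fin d) (Fin d) ℤ).mulVec t, ?_⟩
        rw [Set.image_image]
        simp [latticeMap_latticeMap, latticeMap_one_zero]
      trans := by
        rintro P Q R ⟨A, s, rfl⟩ ⟨B, t, rfl⟩
        exact ⟨B * A, (B : Matrix (Fin d) (Fin d) ℤ).mulVec s + t, by
          rw [Set.image_image]; simp only [latticeMap_latticeMap]⟩ }

/-- The number of lattice-isomorphism classes that meet a family of subsets of `ℝ^d`. -/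
noncomputable def numClasses {d : ℕ} (F : Set (Set (Fin d → ℝ))) : ℕ∞ :=
  (Quotient.mk (latticeSetoid d) '' F).encard

/-- The smooth lattice polygons in the plane with at most `N` lattice points. -/
def smoothPolygons (N : ℕ) : Set (Set (Fin 2 → ℝ)) :=
  {P | IsSmooth P ∧ (latticePoints P).encard ≤ N}

end LatticePolytope

/-!
The boundary of a smooth polygon `P` is followed in counterclockwise order. Let `t`, `u`, `u'` be
the primitive directions of three consecutive edges, and let the middle one go from `v` to
`w = v + l u`. Smoothness means `det (t, u) = det (u, u') = 1`, so `u' = -t + a u` for an integer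
`a`. The points `v - t` and `w + u'` belong to `P` and are both at lattice distance `1` from the
middle edge; by convexity the whole row of `l + a + 1` lattice points between them belongs to `P`.
If `P` has at most `12` lattice points, this leaves finitely many choices for `a` and for the
lengths, and hence finitely many boundary walks from a given first edge.

An affine automorphism of the lattice brings `P` into a normal position: a corner at the origin, its
edges along the axes, the edge on the horizontal axis at least as long as all others. From there
a depth-first search (`search`) over the remaining edges, which keeps a list of known lattice points
of `P` and stops if there are more than `12` or if one of them is on the wrong side of an edge,
finds `45` closed walks. By `EdgeModel.search_sound` the boundary walk of `P` is one of them, and by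
`Trail.eq_polygon` (a fan triangulation) `P` is the convex hull of the vertices on it. Four of the
polygons found are lattice-isomorphic to others, which leaves the `41` polygons of `catalog`.

Conversely `isSmooth_polygon` reduces the smoothness of a polygon of the catalog to finitely many
determinants of its vertices, and `encard_latticePoints_le` bounds its number of lattice points.
The polygons of the catalog are pairwise not isomorphic, because `invariant`, which is computed from
the lattice lengths of all segments between vertices, takes different values on them
(`invariant_eq_of_latticeIso`).
-/

namespace LatticePolytope

/-! ### Lattice points and the catalog of polygons -/

/-- The lattice point `v + k u`. -/
def go (v : ℤ × ℤ) (k : ℤ) (u : ℤ × ℤ) : ℤ × ℤ := (v.1 + k * u.1, v.2 + k * u.2)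

/-- The determinant of `u` and `p - v`: it is nonnegative if `p` is on the left of the line through
`v` in direction `u`, or on the line. Thus `side 0 u w` is the determinant of `u` and `w`. -/
def side (v u p : ℤ × ℤ) : ℤ := u.1 * (p.2 - v.2) - u.2 * (p.1 - v.1)

/-- One polygon from each class, given by its vertices in counterclockwise order, sorted by the
number of vertices. The two edges at the vertex `(0, 0)` lie on the coordinate axes, and no
edge is longer than the one on the horizontal axis. -/
def catalog : List (List (ℤ × ℤ)) := [
  [(0, 0), (1, 0), (0, 1)], [(0, 0), (2, 0), (0, 2)], [(0, 0), (3, 0), (0, 3)],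
  [(0, 0), (1, 0), (1, 1), (0, 1)], [(0, 0), (2, 0), (1, 1), (0, 1)],
  [(0, 0), (2, 0), (2, 1), (0, 1)], [(0, 0), (2, 0), (2, 2), (0, 2)],
  [(0, 0), (3, 0), (1, 1), (0, 1)], [(0, 0), (3, 0), (2, 1), (0, 1)],
  [(0, 0), (3, 0), (1, 2), (0, 2)], [(0, 0), (3, 0), (3, 1), (0, 1)],
  [(0, 0), (3, 0), (3, 2), (0, 2)], [(0, 0), (4, 0), (1, 1), (0, 1)],
  [(0, 0), (4, 0), (2, 1), (0, 1)], [(0, 0), (4, 0), (3, 1), (0, 1)],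
  [(0, 0), (4, 0), (2, 2), (0, 2)], [(0, 0), (4, 0), (4, 1), (0, 1)],
  [(0, 0), (5, 0), (1, 1), (0, 1)], [(0, 0), (5, 0), (2, 1), (0, 1)],
  [(0, 0), (5, 0), (3, 1), (0, 1)], [(0, 0), (5, 0), (1, 2), (0, 2)],
  [(0, 0), (5, 0), (4, 1), (0, 1)], [(0, 0), (5, 0), (5, 1), (0, 1)],
  [(0, 0), (6, 0), (1, 1), (0, 1)], [(0, 0), (6, 0), (2, 1), (0, 1)],
  [(0, 0), (6, 0), (3, 1), (0, 1)], [(0, 0), (6, 0), (4, 1), (0, 1)],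
  [(0, 0), (7, 0), (1, 1), (0, 1)], [(0, 0), (7, 0), (2, 1), (0, 1)],
  [(0, 0), (7, 0), (3, 1), (0, 1)], [(0, 0), (8, 0), (1, 1), (0, 1)],
  [(0, 0), (8, 0), (2, 1), (0, 1)], [(0, 0), (9, 0), (1, 1), (0, 1)],
  [(0, 0), (2, 0), (2, 1), (1, 2), (0, 2)], [(0, 0), (3, 0), (3, 1), (2, 2), (0, 2)],
  [(0, 0), (4, 0), (3, 1), (1, 2), (0, 2)],
  [(0, 0), (1, 0), (2, 1), (2, 2), (1, 2), (0, 1)],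
  [(0, 0), (2, 0), (3, 1), (3, 2), (1, 2), (0, 1)],
  [(0, 0), (2, 0), (3, 1), (3, 3), (2, 3), (0, 1)],
  [(0, 0), (3, 0), (3, 1), (2, 2), (1, 2), (0, 1)],
  [(0, 0), (1, 0), (2, 1), (3, 3), (3, 4), (2, 4), (1, 3), (0, 1)]]

/-- Four polygons that the search finds besides those of the catalog: the normal position of a
polygon is not unique. Each of them is lattice-isomorphic to one of the catalog. -/
def duplicates : List (List (ℤ × ℤ)) := [
  [(0, 0), (2, 0), (2, 2), (1, 2), (0, 1)], [(0, 0), (3, 0), (3, 2), (1, 2), (0, 1)],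
  [(0, 0), (4, 0), (2, 2), (1, 2), (0, 1)],
  [(0, 0), (1, 0), (3, 1), (4, 2), (4, 3), (3, 3), (1, 2), (0, 1)]]

/-! ### The search for closed boundary walks -/

/-- The lattice points `v, v + u, …, v + n u`. -/
def points (v : ℤ × ℤ) (n : ℕ) (u : ℤ × ℤ) : List (ℤ × ℤ) :=
  (List.range (n + 1)).map fun j : ℕ => go v j u

/-- The search for the polygons with at most `12` lattice points and no edge longer than `m`, along
the boundary in counterclockwise order; it returns `true` if all polygons that it meets are in the
catalog or among the duplicates. The first argument bounds the depth. In the others, `v` is the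
current vertex, `u` and `l` are the primitive direction and the length of the edge that leaves it,
`t` is the direction of the edge that enters it, `sides` are the known edges (initial point and
direction), `L` is the list of the vertices met so far, the current one first, and `K` is a
list of known lattice points of the polygon.

The next direction is `u' = -t + (r - l) u` for some `r ≥ 0`, and then the `r + 1` points
`v - t + j u`, for `0 ≤ j ≤ r`, belong to the polygon. A branch is cut if more than `12` lattice
points are known or if a known point is on the wrong side of an edge, and also if the walk returns
to a vertex other than the origin, which is impossible for a polygon. The range of `r` is finite as
the row of `r + 1` points counts towards the `12`. -/
def search (m : ℕ) : ℕ → List ((ℤ × ℤ) × (ℤ × ℤ)) → List (ℤ × ℤ) → List (ℤ × ℤ) →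
    ℤ × ℤ → ℤ × ℤ → ℤ × ℤ → ℕ → Bool
  | 0, _, _, _, _, _, _, _ => false
  | n + 1, sides, L, K, t, v, u, l =>
    (List.range 12).all fun r =>
      let w := go v l u
      let u' := go (-t.1, -t.2) ((r : ℤ) - l) u
      !(sides.all fun s => decide (0 ≤ side s.1 s.2 (go w 1 u'))) ||
      (!(K.all fun q => decide (0 ≤ side w u' q)) ||
      (let K' := points (go v (-1) t) r u ∪ K
      decide (12 < K'.length) ||
      (List.range m).all fun k =>
        let p := go w (k + 1 : ℕ) u'
        !(sides.all fun s => decide (0 ≤ side s.1 s.2 p)) ||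
        (let K'' := points w (k + 1) u' ∪ K'
        decide (12 < K''.length) ||
        (if p ∈ L then
          decide (p ≠ (0, 0)) || decide ((w :: L).reverse ∈ catalog ++ duplicates)
        else search m n ((w, u') :: sides) (w :: L) K'' u w u' (k + 1)))))

/-- The search in normal position: the first edge goes from the origin to `(m, 0)`, and the last
edge descends to the origin along the vertical axis. -/
def searchFrom (m : ℕ) : Bool :=
  search m 12 [((0, 0), (1, 0)), ((0, 0), (0, -1))] [(0, 0)]
    ((0, 1) :: points (0, 0) m (1, 0)) (0, -1) (0, 0) (1, 0) m

theorem searchFrom_eq_true : ∀ m ∈ List.range 12, searchFrom m = true := by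
  decide +kernel

theorem side_go (v u p w : ℤ × ℤ) (k : ℤ) :
    side v u (go p k w) = side v u p + k * side 0 u w := by
  simp only [side, go, Prod.fst_zero, Prod.snd_zero]; ring

theorem go_ne_self (v : ℤ × ℤ) {u : ℤ × ℤ} {k : ℤ} (hk : k ≠ 0) (hu : u ≠ 0) : go v k u ≠ v := by
  intro h
  rw [Prod.ext_iff] at h
  simp only [go, add_eq_left, mul_eq_zero, hk, false_or] at h
  exact hu (Prod.ext h.1 h.2)

/-- `Trail E b L w` means that `w` is reached from `b` by following edges, where `E v u l` says that
there is an edge from `v` to `v + l u`. The list `L` holds the starting points of these edges, the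
last one first, and they are distinct. The end `w` may be equal to one of them. -/
inductive Trail (E : ℤ × ℤ → ℤ × ℤ → ℕ → Prop) (b : ℤ × ℤ) : List (ℤ × ℤ) → ℤ × ℤ → Prop
  | single (u : ℤ × ℤ) (l : ℕ) (h : E b u l) : Trail E b [b] (go b l u)
  | cons (L : List (ℤ × ℤ)) (w u : ℤ × ℤ) (l : ℕ) (hL : Trail E b L w) (hw : w ∉ L)
      (h : E w u l) : Trail E b (w :: L) (go w l u)

theorem Trail.exists_edge {E : ℤ × ℤ → ℤ × ℤ → ℕ → Prop} {b : ℤ × ℤ} {L : List (ℤ × ℤ)}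
    {w : ℤ × ℤ} (h : Trail E b L w) : ∃ v ∈ L, ∃ u l, E v u l ∧ go v l u = w := by
  cases h with
  | single u l h => exact ⟨b, by simp, u, l, h, rfl⟩
  | cons L w u l hL hw h => exact ⟨w, by simp, u, l, h, rfl⟩

theorem Trail.exists_edge_of_mem {E : ℤ × ℤ → ℤ × ℤ → ℕ → Prop} {b : ℤ × ℤ}
    {L : List (ℤ × ℤ)} {w : ℤ × ℤ} (h : Trail E b L w) {q : ℤ × ℤ} (hq : q ∈ L)
    (hb : q ≠ b) : ∃ v ∈ L, ∃ u l, E v u l ∧ go v l u = q := by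
  induction h with
  | single u l h => simp_all
  | cons L w u l hL hw h ih =>
    rcases List.mem_cons.1 hq with rfl | hq
    · obtain ⟨v, hv, h⟩ := hL.exists_edge
      exact ⟨v, by simp [hv], h⟩
    · obtain ⟨v, hv, h⟩ := ih hq
      exact ⟨v, by simp [hv], h⟩

/-- The facts about a polygon on which the search relies. Here `M` is the set of its lattice points,
`E v u l` says that there is an edge from `v` to `v + l u` with the polygon on its left, and `m`
bounds the lengths of the edges that follow another one. -/
structure EdgeModel (m : ℕ) (M : ℤ × ℤ → Prop) (E : ℤ × ℤ → ℤ × ℤ → ℕ → Prop) : Prop where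
  convex : ∀ p u (r j : ℕ), M p → M (go p r u) → j ≤ r → M (go p j u)
  length_le : ∀ L : List (ℤ × ℤ), L.Nodup → (∀ p ∈ L, M p) → L.length ≤ 12
  one_le : ∀ v u l, E v u l → 1 ≤ l
  mem_start : ∀ v u l, E v u l → M v
  mem_end : ∀ v u l, E v u l → M (go v l u)
  side_nonneg : ∀ v u l p, E v u l → M p → 0 ≤ side v u p
  start_unique : ∀ v u l v' u' l', E v u l → E v' u' l' → go v l u = go v' l' u' → v = v'
  next : ∀ v u l, E v u l → ∃ u' l', E (go v l u) u' l' ∧ side 0 u u' = 1 ∧ l' ≤ m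

theorem nodup_points (v : ℤ × ℤ) (n : ℕ) {u : ℤ × ℤ} (hu : u ≠ 0) : (points v n u).Nodup := by
  refine List.Nodup.map ?_ List.nodup_range
  intro i j h
  simp only [go, Prod.mk.injEq, add_right_inj, mul_eq_mul_right_iff, Nat.cast_inj] at h
  by_contra hij
  exact hu (Prod.ext (h.1.resolve_left hij) (h.2.resolve_left hij))

theorem length_points (v : ℤ × ℤ) (n : ℕ) (u : ℤ × ℤ) : (points v n u).length = n + 1 := by
  simp [points]

namespace EdgeModel

variable {m : ℕ} {M : ℤ × ℤ → Prop} {E : ℤ × ℤ → ℤ × ℤ → ℕ → Prop}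

theorem mem_points (h : EdgeModel m M E) {p u : ℤ × ℤ} {r : ℕ} (hp : M p)
    (hr : M (go p r u)) : ∀ q ∈ points p r u, M q := by
  intro q hq
  simp only [points, List.mem_map, List.mem_range] at hq
  obtain ⟨j, hj, rfl⟩ := hq
  exact h.convex p u r j hp hr (by omega)

/-- If the search succeeds from the current state, then the boundary walk closes up at a polygon of
the catalog or a duplicate. A walk cannot return to a vertex other than the origin, because no
vertex is the end of two edges. -/
theorem search_sound (h : EdgeModel m M E) (n : ℕ) (sides : List ((ℤ × ℤ) × (ℤ × ℤ)))
    (L K : List (ℤ × ℤ)) (t v u : ℤ × ℤ) (l : ℕ)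
    (hL : Trail E 0 L (go v l u)) (hw : go v l u ∉ L) (he : E v u l)
    (hs : ∀ s ∈ sides, ∀ p, M p → 0 ≤ side s.1 s.2 p)
    (hK : ∀ p ∈ K, M p) (hKn : K.Nodup) (ht : side 0 t u = 1) (htv : M (go v (-1) t))
    (hts : ∀ p, M p → 0 ≤ side v t p)
    (hsearch : search m n sides L K t v u l = true) :
    ∃ L', Trail E 0 L' 0 ∧ L'.reverse ∈ catalog ++ duplicates := by
  induction n generalizing sides L K t v u l with
  | zero => simp [search] at hsearch
  | succ n ih =>
    obtain ⟨u', l', he', hu', hl'm⟩ := h.next v u l he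
    have hl' := h.one_le _ _ _ he'
    have hu : u ≠ 0 := by rintro rfl; simp [side] at ht
    have hu'0 : u' ≠ 0 := by rintro rfl; simp [side] at hu'
    set w := go v l u with hwdef
    have hmw : M w := h.mem_start _ _ _ he'
    have hmp : M (go w l' u') := h.mem_end _ _ _ he'
    have hm1 : M (go w 1 u') := by
      have := h.convex w u' l' 1 hmw hmp hl'
      simpa using this
    -- `u' = -t + a u`, where `a + l ≥ 0` because `w + u'` lies to the left of `t`
    have hr : 0 ≤ side 0 t u' + l := by
      have h1 := hts _ hm1
      rw [side_go, hwdef, side_go, ht] at h1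
      have h2 : side v t v = 0 := by simp [side]
      rw [h2] at h1
      linarith
    obtain ⟨r, hr⟩ := Int.eq_ofNat_of_zero_le hr
    have hu'eq : u' = go (-t.1, -t.2) ((r : ℤ) - l) u := by
      have ha : (r : ℤ) - l = side 0 t u' := by linarith
      rw [ha]
      simp only [side, Prod.fst_zero, Prod.snd_zero, sub_zero] at ht hu'
      ext
      · simp only [go, side, Prod.fst_zero, Prod.snd_zero, sub_zero]
        linear_combination (-u'.1) * ht - t.1 * hu'
      · simp only [go, side, Prod.fst_zero, Prod.snd_zero, sub_zero]
        linear_combination (-u'.2) * ht - t.2 * hu'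
    have hrow : go (go v (-1) t) r u = go w 1 u' := by
      rw [hu'eq, hwdef]
      ext <;> simp only [go] <;> ring
    have hrowM := h.mem_points htv (hrow ▸ hm1)
    have hr12 : r < 12 := by
      have := h.length_le _ (nodup_points (go v (-1) t) r hu) hrowM
      rw [length_points] at this
      omega
    have hS := hsearch
    rw [search, List.all_eq_true] at hS
    have hS := hS r (List.mem_range.2 hr12)
    simp only [← hu'eq, ← hwdef] at hS
    have hsides : ∀ p, M p → (sides.all fun s => decide (0 ≤ side s.1 s.2 p)) = true := by
      intro p hp
      simp only [List.all_eq_true, decide_eq_true_eq]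
      exact fun s hs' => hs s hs' p hp
    have hKall : (K.all fun q => decide (0 ≤ side w u' q)) = true := by
      simp only [List.all_eq_true, decide_eq_true_eq]
      exact fun q hq => h.side_nonneg _ _ _ _ he' (hK q hq)
    rw [hsides _ hm1, hKall] at hS
    -- the row of lattice points parallel to the current edge, next to it
    set K' := points (go v (-1) t) r u ∪ K with hK'
    have hK'M : ∀ p ∈ K', M p := by
      intro p hp
      rcases List.mem_union_iff.1 hp with hp | hp
      exacts [hrowM p hp, hK p hp]
    have hK'n : K'.Nodup := hKn.union _
    have hK'12 : ¬ 12 < K'.length := not_lt.2 (h.length_le _ hK'n hK'M)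
    simp only [Bool.not_true, Bool.false_or, hK'12, decide_false, List.all_eq_true] at hS
    have hS := hS (l' - 1) (List.mem_range.2 (by omega))
    rw [Nat.sub_add_cancel hl', hsides _ hmp] at hS
    set K'' := points w l' u' ∪ K' with hK''
    have hK''M : ∀ p ∈ K'', M p := by
      intro p hp
      rcases List.mem_union_iff.1 hp with hp | hp
      exacts [h.mem_points hmw hmp p hp, hK'M p hp]
    have hK''n : K''.Nodup := hK'n.union _
    have hK''12 : ¬ 12 < K''.length := not_lt.2 (h.length_le _ hK''n hK''M)
    simp only [Bool.not_true, Bool.false_or, hK''12, decide_false] at hS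
    have hT : Trail E 0 (w :: L) (go w l' u') := .cons L w u' l' hL hw he'
    split_ifs at hS with hpL
    · simp only [Bool.or_eq_true, decide_eq_true_eq] at hS
      by_cases hp0 : go w l' u' = (0, 0)
      · refine ⟨w :: L, ?_, hS.resolve_left (not_not.2 hp0)⟩
        rw [hp0] at hT
        exact hT
      · obtain ⟨v₁, hv₁, u₁, l₁, he₁, hq⟩ := hL.exists_edge_of_mem hpL hp0
        exact absurd (h.start_unique _ _ _ _ _ _ he₁ he' hq ▸ hv₁) hw
    · refine ih ((w, u') :: sides) (w :: L) K'' u w u' l' hT ?_ he' ?_ hK''M hK''n hu' ?_ ?_ hS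
      · exact fun hmem => (List.mem_cons.1 hmem).elim (go_ne_self w (by omega) hu'0) hpL
      · intro s hs' p hp
        rcases List.mem_cons.1 hs' with rfl | hs'
        exacts [h.side_nonneg _ _ _ _ he' hp, hs s hs' p hp]
      · have : go w (-1) u = go v ((l - 1 : ℕ) : ℤ) u := by
          have h1 := h.one_le _ _ _ he
          rw [hwdef, Nat.cast_sub h1]
          ext <;> simp only [go] <;> push_cast <;> ring
        rw [this]
        exact h.convex v u l (l - 1) (h.mem_start _ _ _ he) hmw (by omega)
      · intro p hp
        have h1 := h.side_nonneg _ _ _ _ he hp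
        have h2 : side w u p = side v u p := by
          rw [hwdef]; simp only [side, go]; ring
        rwa [h2]

theorem exists_closed_trail (h : EdgeModel m M E) (he : E 0 (1, 0) m) (hy : M (0, 1))
    (hx : ∀ p, M p → 0 ≤ p.1) :
    ∃ L, Trail E 0 L 0 ∧ L.reverse ∈ catalog ++ duplicates := by
  have hm := h.one_le _ _ _ he
  have h0 : M 0 := h.mem_start _ _ _ he
  have hpts := h.mem_points h0 (h.mem_end _ _ _ he)
  have hm12 : m < 12 := by
    have := h.length_le _ (nodup_points 0 m (by simp)) hpts
    rw [length_points] at this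
    omega
  have hL : Trail E 0 [0] (go 0 m (1, 0)) := .single _ _ he
  refine h.search_sound 12 [((0, 0), (1, 0)), ((0, 0), (0, -1))] [0]
    ((0, 1) :: points (0, 0) m (1, 0)) (0, -1) 0 (1, 0) m hL ?_ he ?_ ?_ ?_ ?_ ?_ ?_
    (searchFrom_eq_true m (List.mem_range.2 hm12))
  · rw [List.mem_singleton, Prod.ext_iff]
    simp [go]
    omega
  · intro s hs p hp
    simp only [List.mem_cons, List.not_mem_nil, or_false] at hs
    rcases hs with rfl | rfl
    · exact h.side_nonneg _ _ _ _ he hp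
    · simpa [side] using hx p hp
  · intro p hp
    rcases List.mem_cons.1 hp with rfl | hp
    exacts [hy, hpts p hp]
  · refine List.nodup_cons.2 ⟨?_, nodup_points _ _ (by simp)⟩
    simp [points, go]
  · simp [side]
  · simpa [go] using hy
  · intro p hp
    simpa [side] using hx p hp

end EdgeModel

/-! ### The edges of a smooth polygon -/

/-- The lattice point `z ∈ ℤ²` as a point of the plane. -/
def toR (z : ℤ × ℤ) : Fin 2 → ℝ := toReal ![z.1, z.2]

@[simp] theorem toR_zero (z : ℤ × ℤ) : toR z 0 = z.1 := rfl
@[simp] theorem toR_one (z : ℤ × ℤ) : toR z 1 = z.2 := rfl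

/-- The determinant of two vectors of the plane. -/
def cross (u p : Fin 2 → ℝ) : ℝ := u 0 * p 1 - u 1 * p 0

theorem cross_toR (v u p : ℤ × ℤ) : cross (toR u) (toR p - toR v) = side v u p := by
  simp [cross, side]

theorem toR_injective : Function.Injective toR := by
  intro a b h
  have h0 := congrFun h 0
  have h1 := congrFun h 1
  simp only [toR_zero, toR_one, Int.cast_inj] at h0 h1
  exact Prod.ext h0 h1

theorem exists_toR (z : Fin 2 → ℤ) : ∃ p : ℤ × ℤ, ![p.1, p.2] = z :=
  ⟨(z 0, z 1), by ext i; fin_cases i <;> rfl⟩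

theorem toR_go (v u : ℤ × ℤ) (k : ℤ) : toR (go v k u) = toR v + (k : ℝ) • toR u := by
  ext i; fin_cases i <;> simp [go]

theorem toR_go_mem_segment (p u : ℤ × ℤ) {r j : ℕ} (h : j ≤ r) :
    toR (go p j u) ∈ segment ℝ (toR p) (toR (go p r u)) := by
  rcases Nat.eq_zero_or_pos r with rfl | hr
  · obtain rfl : j = 0 := by omega
    exact right_mem_segment ℝ _ _
  · have hr' : (0 : ℝ) < r := by exact_mod_cast hr
    rw [segment_eq_image']
    refine ⟨j / r, ⟨by positivity, div_le_one_of_le₀ (by exact_mod_cast h) hr'.le⟩, ?_⟩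
    simp only [toR_go, Int.cast_natCast, add_sub_cancel_left, smul_smul,
      div_mul_cancel₀ _ hr'.ne']

/-- Cramer's rule in the plane. -/
theorem cross_smul (a b x : Fin 2 → ℝ) : cross a b • x = cross x b • a + cross a x • b := by
  ext i; fin_cases i <;> simp [cross] <;> ring

theorem cross_smul_right (a x : Fin 2 → ℝ) (c : ℝ) : cross a (c • x) = c * cross a x := by
  simp [cross]; ring

theorem cross_smul_left (a x : Fin 2 → ℝ) (c : ℝ) : cross (c • a) x = c * cross a x := by
  simp [cross]; ring

/-- A polygon lies on one side of the line through an edge, namely on the side of any point `w'` off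
that line, and meets the line in the edge only: up to a factor, the functional that exposes the edge
is the determinant with its direction. -/
theorem mul_cross_nonneg_of_isExposed {P : Set (Fin 2 → ℝ)} {v w w' : Fin 2 → ℝ}
    (h : IsExposed ℝ P (segment ℝ v w)) (hw' : w' ∈ P) (hw'n : w' ∉ segment ℝ v w)
    {p : Fin 2 → ℝ} (hp : p ∈ P) (hc : cross (w - v) (w' - v) ≠ 0) :
    0 ≤ cross (w - v) (w' - v) * cross (w - v) (p - v) ∧
      (cross (w - v) (p - v) = 0 → p ∈ segment ℝ v w) := by
  obtain ⟨f, hf⟩ := h ⟨v, left_mem_segment ℝ v w⟩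
  have hv : v ∈ P ∧ ∀ y ∈ P, f y ≤ f v := by
    have := left_mem_segment ℝ v w
    rw [hf] at this; exact this
  have hw : w ∈ P ∧ ∀ y ∈ P, f y ≤ f w := by
    have := right_mem_segment ℝ v w
    rw [hf] at this; exact this
  have hwv : f (w - v) = 0 := by
    rw [map_sub, sub_eq_zero]; exact le_antisymm (hv.2 _ hw.1) (hw.2 _ hv.1)
  have hw'v : f (w' - v) < 0 := by
    rw [map_sub, sub_neg]
    refine lt_of_le_of_ne (hv.2 _ hw') fun he => hw'n ?_
    rw [hf]; exact ⟨hw', fun y hy => he ▸ hv.2 y hy⟩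
  have hpv : f (p - v) ≤ 0 := by rw [map_sub, sub_nonpos]; exact hv.2 p hp
  have key := congrArg f (cross_smul (w - v) (w' - v) (p - v))
  simp only [map_add, map_smul, hwv, smul_eq_mul, mul_zero, zero_add] at key
  constructor
  · set σ := cross (w - v) (w' - v)
    have h1 : 0 ≤ σ * σ * (f (p - v) * f (w' - v)) :=
      mul_nonneg (mul_self_nonneg σ) (mul_nonneg_of_nonpos_of_nonpos hpv hw'v.le)
    have h2 : σ * σ * (f (p - v) * f (w' - v)) =
        σ * cross (w - v) (p - v) * (f (w' - v) * f (w' - v)) := by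
      linear_combination σ * f (w' - v) * key
    rw [h2] at h1
    exact nonneg_of_mul_nonneg_left h1 (mul_pos_of_neg_of_neg hw'v hw'v)
  · intro h0
    rw [h0, zero_mul] at key
    have h1 : f (p - v) = 0 := (mul_eq_zero.1 key).resolve_left hc
    rw [map_sub, sub_eq_zero] at h1
    rw [hf]; exact ⟨hp, fun y hy => h1 ▸ hv.2 y hy⟩

/-- `P` has an edge from the lattice point `v` to `v + l u`, where `u` is primitive, and lies on the
left of it. Primitivity is expressed by the existence of a vector `c` with `det (u, c) = 1`. -/
structure IsEdge (P : Set (Fin 2 → ℝ)) (v u : ℤ × ℤ) (l : ℕ) : Prop where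
  one_le : 1 ≤ l
  start_mem : toR v ∈ vertices P
  end_mem : toR (go v l u) ∈ vertices P
  isPrimitive : ∃ c, side 0 u c = 1
  cross_nonneg : ∀ p ∈ P, 0 ≤ cross (toR u) (p - toR v)
  mem_segment : ∀ p ∈ P, cross (toR u) (p - toR v) = 0 →
    p ∈ segment ℝ (toR v) (toR (go v l u))

theorem eq_smul_primitive {d : ℕ} {z : Fin d → ℤ} (hz : z ≠ 0) :
    ∃ g : ℕ, 1 ≤ g ∧ z = (g : ℤ) • primitive z := by
  have h0 : Finset.univ.gcd z ≠ 0 := by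
    rw [Ne, Finset.gcd_eq_zero_iff]
    intro h
    exact hz (funext fun i => h i (Finset.mem_univ i))
  have hn : 0 ≤ Finset.univ.gcd z := by
    have := Finset.normalize_gcd (s := Finset.univ) (f := z)
    rw [← this]
    exact Int.nonneg_of_normalize_eq_self (by simp)
  obtain ⟨g, hg⟩ := Int.eq_ofNat_of_zero_le hn
  refine ⟨g, ?_, ?_⟩
  · have : g ≠ 0 := by rintro rfl; exact h0 hg
    omega
  · funext i
    simp only [primitive, Pi.smul_apply, smul_eq_mul, ← hg]
    exact (Int.mul_ediv_cancel' (Finset.gcd_dvd (Finset.mem_univ i))).symm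

theorem not_mem_segment_of_vertex {P : Set (Fin 2 → ℝ)} {v w x : Fin 2 → ℝ}
    (hx : x ∈ vertices P) (hv : v ∈ P) (hw : w ∈ P) (hxv : x ≠ v) (hxw : x ≠ w) :
    x ∉ segment ℝ v w := by
  intro h
  rcases (mem_extremePoints_iff_forall_segment.1 hx).2 v hv w hw h with h | h
  exacts [hxv h.symm, hxw h.symm]

/-- An exposed segment from `v` in direction `d` is an oriented edge: it leaves `v` or it enters
`v`, according to the orientation of `d` and another edge direction `x` at `v`. -/
theorem isEdge_of_isExposed {P : Set (Fin 2 → ℝ)} {v d x : ℤ × ℤ} {l k : ℕ} (hl : 1 ≤ l)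
    (hv : toR v ∈ vertices P) (hw : toR (go v l d) ∈ vertices P)
    (hx : toR (go v k x) ∈ vertices P) (hk : 1 ≤ k)
    (he : IsExposed ℝ P (segment ℝ (toR v) (toR (go v l d)))) :
    (side 0 d x = 1 → IsEdge P v d l) ∧
      (side 0 d x = -1 → IsEdge P (go v l d) (-d) l) := by
  have hl' : (0 : ℝ) < l := by exact_mod_cast hl
  have hk' : (0 : ℝ) < k := by exact_mod_cast hk
  have hcr : cross (toR (go v l d) - toR v) (toR (go v k x) - toR v) =
      l * k * side 0 d x := by
    rw [toR_go, toR_go]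
    simp [cross, side]
    ring
  have hp : ∀ p, cross (toR (go v l d) - toR v) (p - toR v) =
      l * cross (toR d) (p - toR v) := by
    intro p
    rw [toR_go, add_sub_cancel_left, cross_smul_left]
    simp
  have hne : side 0 d x ≠ 0 → toR (go v k x) ∉ segment ℝ (toR v) (toR (go v l d)) := by
    intro h0
    have h1 : cross (toR (go v l d) - toR v) (toR (go v k x) - toR v) ≠ 0 := by
      rw [hcr]
      have : (side 0 d x : ℝ) ≠ 0 := by exact_mod_cast h0
      positivity
    refine not_mem_segment_of_vertex hx hv.1 hw.1 ?_ ?_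
    · intro h; rw [h] at h1; simp [cross] at h1
    · intro h; rw [h] at h1; simp [cross] at h1; apply h1; ring
  have key : ∀ p ∈ P, side 0 d x ≠ 0 → 0 ≤ (side 0 d x : ℝ) * cross (toR d) (p - toR v) ∧
      (cross (toR d) (p - toR v) = 0 → p ∈ segment ℝ (toR v) (toR (go v l d))) := by
    intro p hpP h0
    have h0' : (side 0 d x : ℝ) ≠ 0 := by exact_mod_cast h0
    have := mul_cross_nonneg_of_isExposed he hx.1 (hne h0) hpP
      (by rw [hcr]; positivity)
    rw [hcr, hp] at this
    refine ⟨?_, fun h => this.2 (by rw [h, mul_zero])⟩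
    have h2 : (l * k * side 0 d x : ℝ) * (l * cross (toR d) (p - toR v)) =
      (l * k * l) * (side 0 d x * cross (toR d) (p - toR v)) := by ring
    rw [h2] at this
    exact nonneg_of_mul_nonneg_right this.1 (by positivity)
  constructor
  · intro h
    refine ⟨hl, hv, hw, ⟨x, h⟩, fun p hpP => ?_, fun p hpP => (key p hpP (by omega)).2⟩
    have := (key p hpP (by omega)).1
    rwa [h, Int.cast_one, one_mul] at this
  · intro h
    have hback : go (go v l d) l (-d) = v := by
      ext <;> simp [go]
    have hc : ∀ p, cross (toR (-d)) (p - toR (go v l d)) = - cross (toR d) (p - toR v) := by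
      intro p
      rw [toR_go]
      simp [cross]
      ring
    refine ⟨hl, hw, by rwa [hback], ⟨x, by simp [side] at h ⊢; linarith⟩, fun p hpP => ?_,
      fun p hpP h0 => ?_⟩
    · have := (key p hpP (by omega)).1
      rw [h] at this
      rw [hc]
      push_cast at this
      linarith
    · rw [hback, segment_symm]
      refine (key p hpP (by omega)).2 ?_
      rw [hc] at h0
      linarith

/-- At each vertex of a smooth polygon an edge enters and another one leaves, and their directions
form a positively oriented basis of the lattice. -/
theorem IsSmooth.exists_corner {P : Set (Fin 2 → ℝ)} (hP : IsSmooth P) {v : ℤ × ℤ}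
    (hv : toR v ∈ vertices P) : ∃ a la b lb, IsEdge P (go v (-(la : ℕ)) a) a la ∧
      IsEdge P v b lb ∧ side 0 a b = 1 := by
  obtain ⟨w, -, hwn, hdet⟩ := hP.det_eq ![v.1, v.2] hv
  have hw : ∀ i, toReal (w i) ∈ neighbors P (toR v) := fun i => by
    have h : toReal (w i) ∈ Set.range fun i => toReal (w i) := ⟨i, rfl⟩
    rw [hwn] at h; exact h
  have hd : ∀ i, ∃ (d : ℤ × ℤ) (g : ℕ), 1 ≤ g ∧ primitive (w i - ![v.1, v.2]) = ![d.1, d.2] ∧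
      toReal (w i) = toR (go v g d) := by
    intro i
    have hne : w i - ![v.1, v.2] ≠ 0 := by
      intro h
      rw [sub_eq_zero] at h
      exact (hw i).2.1 (by rw [h]; rfl)
    obtain ⟨g, hg, h⟩ := eq_smul_primitive hne
    obtain ⟨d, hd⟩ := exists_toR (primitive (w i - ![v.1, v.2]))
    refine ⟨d, g, hg, hd.symm, ?_⟩
    rw [← hd, sub_eq_iff_eq_add] at h
    rw [h]
    ext j; fin_cases j <;> simp [toReal, toR, go, add_comm]
  choose d g hg hdp hwg using hd
  rw [Matrix.det_fin_two] at hdet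
  simp only [Matrix.of_apply, hdp, Matrix.cons_val_zero, Matrix.cons_val_one] at hdet
  have hv' : ∀ i, toR (go v (g i) (d i)) ∈ vertices P := fun i => hwg i ▸ (hw i).1
  have he : ∀ i, IsExposed ℝ P (segment ℝ (toR v) (toR (go v (g i) (d i)))) :=
    fun i => hwg i ▸ (hw i).2.2
  have h01 := isEdge_of_isExposed (hg 0) hv (hv' 0) (hv' 1) (hg 1) (he 0)
  have h10 := isEdge_of_isExposed (hg 1) hv (hv' 1) (hv' 0) (hg 0) (he 1)
  have hgo : ∀ i, go v (-(g i : ℕ)) (-d i) = go v (g i) (d i) := by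
    intro i; ext <;> simp [go]
  rcases hdet with h | h
  · refine ⟨-d 1, g 1, d 0, g 0, ?_, h01.1 ?_, ?_⟩
    · rw [hgo]; exact h10.2 (by simp [side]; linarith)
    · simp [side]; linarith
    · simp [side]; linarith
  · refine ⟨-d 0, g 0, d 1, g 1, ?_, h10.1 ?_, ?_⟩
    · rw [hgo]; exact h01.2 (by simp [side]; linarith)
    · simp [side]; linarith
    · simp [side]; linarith

/-! ### A closed boundary walk determines the polygon -/

theorem IsEdge.side_nonneg {P : Set (Fin 2 → ℝ)} {v u p : ℤ × ℤ} {l : ℕ} (h : IsEdge P v u l)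
    (hp : toR p ∈ P) : 0 ≤ side v u p := by
  have := h.cross_nonneg _ hp
  rw [cross_toR] at this
  exact_mod_cast this

theorem IsEdge.ne_zero {P : Set (Fin 2 → ℝ)} {v u : ℤ × ℤ} {l : ℕ} (h : IsEdge P v u l) :
    u ≠ 0 := by
  rintro rfl
  obtain ⟨c, hc⟩ := h.isPrimitive
  simp [side] at hc

theorem IsEdge.eq_or_eq_of_side_eq_zero {P : Set (Fin 2 → ℝ)} {v u p : ℤ × ℤ} {l : ℕ}
    (h : IsEdge P v u l) (hp : toR p ∈ vertices P) (h0 : side v u p = 0) :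
    p = v ∨ p = go v l u := by
  have h1 := h.mem_segment _ hp.1 (by rw [cross_toR, h0, Int.cast_zero])
  rcases (mem_extremePoints_iff_forall_segment.1 hp).2 _ h.start_mem.1 _ h.end_mem.1 h1 with
    h2 | h2
  exacts [.inl (toR_injective h2.symm), .inr (toR_injective h2.symm)]

/-- A vertex is the end of only one edge: each of two such edges has the start of the other one on
its left, so the two are parallel. -/
theorem IsEdge.start_unique {P : Set (Fin 2 → ℝ)} {v u v' u' : ℤ × ℤ} {l l' : ℕ}
    (h : IsEdge P v u l) (h' : IsEdge P v' u' l') (hq : go v l u = go v' l' u') : v = v' := by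
  have hl : (1 : ℤ) ≤ l := by exact_mod_cast h.one_le
  have hl' : (1 : ℤ) ≤ l' := by exact_mod_cast h'.one_le
  have h1 := h.side_nonneg h'.start_mem.1
  have h2 := h'.side_nonneg h.start_mem.1
  have hq' := hq
  simp only [go, Prod.mk.injEq] at hq
  have e1 : side v u v' = -l' * side 0 u u' := by
    simp only [side, Prod.fst_zero, Prod.snd_zero]
    linear_combination u.2 * hq.1 - u.1 * hq.2
  have e2 : side v' u' v = l * side 0 u u' := by
    simp only [side, Prod.fst_zero, Prod.snd_zero]
    linear_combination u'.1 * hq.2 - u'.2 * hq.1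
  have h0 : side 0 u u' = 0 := by nlinarith
  rcases h.eq_or_eq_of_side_eq_zero h'.start_mem (by rw [e1, h0, mul_zero]) with h3 | h3
  · exact h3.symm
  · exact absurd (hq'.symm.trans h3.symm) (go_ne_self _ (by omega) h'.ne_zero)

theorem IsEdge.direction_unique {P : Set (Fin 2 → ℝ)} {v u u' : ℤ × ℤ} {l l' : ℕ}
    (h : IsEdge P v u l) (h' : IsEdge P v u' l') (hq : go v l u = go v l' u') : u = u' := by
  have hl := h.one_le
  obtain ⟨c, hc⟩ := h.isPrimitive
  obtain ⟨c', hc'⟩ := h'.isPrimitive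
  simp only [go, Prod.mk.injEq, add_right_inj] at hq
  simp only [side, Prod.fst_zero, Prod.snd_zero, sub_zero] at hc hc'
  have h1 : (l' : ℤ) ∣ l := ⟨u'.1 * c.2 - u'.2 * c.1, by
    linear_combination (-l : ℤ) * hc + c.2 * hq.1 - c.1 * hq.2⟩
  have h2 : (l : ℤ) ∣ l' := ⟨u.1 * c'.2 - u.2 * c'.1, by
    linear_combination (-l' : ℤ) * hc' - c'.2 * hq.1 + c'.1 * hq.2⟩
  have h3 : l = l' := Nat.dvd_antisymm (Int.natCast_dvd_natCast.1 h2) (Int.natCast_dvd_natCast.1 h1)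
  subst h3
  have h4 : (l : ℤ) ≠ 0 := by omega
  exact Prod.ext (mul_left_cancel₀ h4 hq.1) (mul_left_cancel₀ h4 hq.2)

theorem Trail.base_mem {E : ℤ × ℤ → ℤ × ℤ → ℕ → Prop} {b : ℤ × ℤ} {L : List (ℤ × ℤ)}
    {w : ℤ × ℤ} (h : Trail E b L w) : b ∈ L := by
  induction h with
  | single => simp
  | cons _ _ _ _ _ _ _ ih => exact List.mem_cons_of_mem _ ih

theorem Trail.exists_edge_start {E : ℤ × ℤ → ℤ × ℤ → ℕ → Prop} {b : ℤ × ℤ} {L : List (ℤ × ℤ)}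
    {w : ℤ × ℤ} (h : Trail E b L w) {q : ℤ × ℤ} (hq : q ∈ L) : ∃ u l, E q u l := by
  induction h with
  | single u l h => exact ⟨u, l, by simp_all⟩
  | cons L w u l hL hw h ih =>
    rcases List.mem_cons.1 hq with rfl | hq
    exacts [⟨u, l, h⟩, ih hq]

/-- The fan triangulation of a polygon: a point of `P` on the left of the diagonal from the first
vertex to the current one is either on the left of the next diagonal or in the triangle between the
two. -/
theorem Trail.mem_convexHull_or {P : Set (Fin 2 → ℝ)} {b : ℤ × ℤ} {L : List (ℤ × ℤ)} {w : ℤ × ℤ}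
    (h : Trail (IsEdge P) b L w) {p : Fin 2 → ℝ} (hp : p ∈ P) :
    p ∈ convexHull ℝ (toR '' {z | z ∈ w :: L}) ∨ 0 ≤ cross (toR w - toR b) (p - toR b) := by
  induction h with
  | single u l h =>
    right
    rw [toR_go, add_sub_cancel_left, cross_smul_left]
    exact mul_nonneg (by simp) (h.cross_nonneg p hp)
  | cons L w u l hL hw h ih =>
    rcases ih with ih | ih
    · refine .inl (convexHull_mono (Set.image_mono ?_) ih)
      intro z hz
      exact List.mem_cons_of_mem _ hz
    rw [or_iff_not_imp_right, not_le]
    intro hx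
    set q := go w l u with hq
    have hA : 0 ≤ (l : ℝ) * cross (toR u) (p - toR w) :=
      mul_nonneg (by simp) (h.cross_nonneg p hp)
    have hlu : (l : ℝ) * cross (toR u) (p - toR w) = cross (toR q - toR w) (p - toR w) := by
      rw [hq, toR_go, add_sub_cancel_left, cross_smul_left, Int.cast_natCast]
    rw [hlu] at hA
    -- the barycentric coordinates of `p` in the triangle `b, w, q`, up to the factor `S`
    set S := cross (toR w - toR b) (toR q - toR b) with hS
    have hsum : cross (toR q - toR w) (p - toR w) + -cross (toR q - toR b) (p - toR b) +
        cross (toR w - toR b) (p - toR b) = S := by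
      simp only [hS, cross, Pi.sub_apply]; ring
    have hpos : 0 < S := by linarith
    have hcomb : p = (cross (toR q - toR w) (p - toR w) / S) • toR b +
        (-cross (toR q - toR b) (p - toR b) / S) • toR w +
        (cross (toR w - toR b) (p - toR b) / S) • toR q := by
      have hne := hpos.ne'
      have : S • p = cross (toR q - toR w) (p - toR w) • toR b +
          (-cross (toR q - toR b) (p - toR b)) • toR w +
          cross (toR w - toR b) (p - toR b) • toR q := by
        ext i; fin_cases i <;> simp [hS, cross] <;> ring
      rw [div_eq_inv_mul, div_eq_inv_mul, div_eq_inv_mul, mul_smul, mul_smul, mul_smul,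
        ← smul_add, ← smul_add, ← this, inv_smul_smul₀ hne]
    have hmem : ∀ z ∈ q :: w :: L, toR z ∈ convexHull ℝ (toR '' {z | z ∈ q :: w :: L}) :=
      fun z hz => subset_convexHull ℝ _ ⟨z, hz, rfl⟩
    have hsmem := (convex_convexHull ℝ (toR '' {z | z ∈ q :: w :: L})).sum_mem
      (t := Finset.univ) (w := ![cross (toR q - toR w) (p - toR w) / S,
        -cross (toR q - toR b) (p - toR b) / S, cross (toR w - toR b) (p - toR b) / S])
      (z := ![toR b, toR w, toR q]) ?_ ?_ ?_
    · rw [Fin.sum_univ_three] at hsmem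
      rw [hcomb]
      exact hsmem
    · intro i _
      fin_cases i
      · exact div_nonneg hA hpos.le
      · exact div_nonneg (by linarith) hpos.le
      · exact div_nonneg ih hpos.le
    · rw [Fin.sum_univ_three]
      change _ / S + _ / S + _ / S = 1
      rw [← add_div, ← add_div, hsum, div_self hpos.ne']
    · intro i _
      fin_cases i
      · exact hmem b (by simp [hL.base_mem])
      · exact hmem w (by simp)
      · exact hmem q (by simp)

/-- The convex hull of the given lattice points. -/
def polygon (V : List (ℤ × ℤ)) : Set (Fin 2 → ℝ) := convexHull ℝ (toR '' {z | z ∈ V})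

/-- After the last edge a point outside of the fan would be on both sides of that edge, hence on
it. -/
theorem Trail.eq_polygon {P : Set (Fin 2 → ℝ)} (hP : Convex ℝ P) {b : ℤ × ℤ} {L : List (ℤ × ℤ)}
    (h : Trail (IsEdge P) b L b) : P = polygon L := by
  refine Set.Subset.antisymm (fun p hp => ?_) (convexHull_min ?_ hP)
  · generalize hw : b = w at h
    have h' : Trail (IsEdge P) b L w := by rw [← hw] at h ⊢; exact h
    clear h
    cases h' with
    | single u l h =>
      exact absurd hw.symm (go_ne_self _ (by have := h.one_le; omega) h.ne_zero)
    | cons L w u l hL hwL h =>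
      rcases hL.mem_convexHull_or hp with hc | hc
      · exact hc
      have h1 := h.cross_nonneg p hp
      have hl : (0 : ℝ) < l := by exact_mod_cast h.one_le
      have h2 : (l : ℝ) * cross (toR u) (p - toR w) = -cross (toR w - toR b) (p - toR b) := by
        have h3 : toR b - toR w = (l : ℝ) • toR u := by
          rw [hw, toR_go, add_sub_cancel_left, Int.cast_natCast]
        rw [← cross_smul_left, ← h3]
        simp only [cross, Pi.sub_apply]; ring
      have h4 : cross (toR u) (p - toR w) = 0 := by nlinarith
      have h5 := h.mem_segment p hp h4
      rw [← hw] at h5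
      refine (convex_convexHull ℝ _).segment_subset (subset_convexHull ℝ _ ?_)
        (subset_convexHull ℝ _ ?_) h5
      · exact ⟨w, by simp, rfl⟩
      · exact ⟨b, List.mem_cons_of_mem _ hL.base_mem, rfl⟩
  · rintro _ ⟨z, hz, rfl⟩
    obtain ⟨u, l, h⟩ := h.exists_edge_start hz
    exact h.start_mem.1

/-! ### Normal position -/

/-- The lattice point with coordinates `z` in the frame with origin `b` and axes `e`, `f`. -/
def frame (b e f z : ℤ × ℤ) : ℤ × ℤ := go (go b z.1 e) z.2 f

theorem frame_go (b e f v u : ℤ × ℤ) (k : ℤ) :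
    frame b e f (go v k u) = go (frame b e f v) k (frame 0 e f u) := by
  ext <;> simp [frame, go] <;> ring

theorem side_frame {e f : ℤ × ℤ} (h : side 0 e f = 1) (b v u p : ℤ × ℤ) :
    side (frame b e f v) (frame 0 e f u) (frame b e f p) = side v u p := by
  have : side (frame b e f v) (frame 0 e f u) (frame b e f p) = side 0 e f * side v u p := by
    simp [side, frame, go]; ring
  rw [this, h, one_mul]

theorem side_frame_zero {e f : ℤ × ℤ} (h : side 0 e f = 1) (u p : ℤ × ℤ) :
    side 0 (frame 0 e f u) (frame 0 e f p) = side 0 u p := by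
  have := side_frame h 0 0 u p
  rwa [show frame 0 e f 0 = 0 by simp [frame, go]] at this

theorem gcd_frame {e f : ℤ × ℤ} (h : side 0 e f = 1 ∨ side 0 e f = -1) (b v w : ℤ × ℤ) :
    Int.gcd ((frame b e f v).1 - (frame b e f w).1) ((frame b e f v).2 - (frame b e f w).2) =
      Int.gcd (v.1 - w.1) (v.2 - w.2) := by
  simp only [side, Prod.fst_zero, Prod.snd_zero, sub_zero] at h
  have h1 : (frame b e f v).1 - (frame b e f w).1 = (v.1 - w.1) * e.1 + (v.2 - w.2) * f.1 := by
    simp only [frame, go]; ring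
  have h2 : (frame b e f v).2 - (frame b e f w).2 = (v.1 - w.1) * e.2 + (v.2 - w.2) * f.2 := by
    simp only [frame, go]; ring
  rw [h1, h2]
  generalize v.1 - w.1 = x
  generalize v.2 - w.2 = y
  apply Nat.dvd_antisymm
  · have d1 := Int.gcd_dvd_left (a := x * e.1 + y * f.1) (b := x * e.2 + y * f.2)
    have d2 := Int.gcd_dvd_right (a := x * e.1 + y * f.1) (b := x * e.2 + y * f.2)
    have d3 := dvd_sub (d1.mul_right f.2) (d2.mul_right f.1)
    have d4 := dvd_sub (d2.mul_right e.1) (d1.mul_right e.2)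
    have e3 : (x * e.1 + y * f.1) * f.2 - (x * e.2 + y * f.2) * f.1 =
      x * (e.1 * f.2 - e.2 * f.1) := by ring
    have e4 : (x * e.2 + y * f.2) * e.1 - (x * e.1 + y * f.1) * e.2 =
      y * (e.1 * f.2 - e.2 * f.1) := by ring
    rw [e3] at d3
    rw [e4] at d4
    apply Int.natCast_dvd_natCast.1
    rcases h with h | h <;> rw [h] at d3 d4
    · exact Int.dvd_coe_gcd (by simpa using d3) (by simpa using d4)
    · exact Int.dvd_coe_gcd (by simpa using d3) (by simpa using d4)
  · apply Int.natCast_dvd_natCast.1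
    have d1 := Int.gcd_dvd_left (a := x) (b := y)
    have d2 := Int.gcd_dvd_right (a := x) (b := y)
    exact Int.dvd_coe_gcd (dvd_add (d1.mul_right _) (d2.mul_right _))
      (dvd_add (d1.mul_right _) (d2.mul_right _))

theorem frame_injective {e f : ℤ × ℤ} (h : side 0 e f = 1 ∨ side 0 e f = -1) (b : ℤ × ℤ) :
    Function.Injective (frame b e f) := by
  intro v w hvw
  have h1 := gcd_frame h b v w
  rw [hvw, sub_self, sub_self, Int.gcd_self, Int.natAbs_zero, eq_comm, Int.gcd_eq_zero_iff] at h1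
  exact Prod.ext (sub_eq_zero.1 h1.1) (sub_eq_zero.1 h1.2)

theorem exists_frame_eq {e f : ℤ × ℤ} (h : side 0 e f = 1) (z : ℤ × ℤ) :
    ∃ x, frame 0 e f x = z := by
  refine ⟨(side 0 z f, side 0 e z), ?_⟩
  simp only [side, Prod.fst_zero, Prod.snd_zero, sub_zero] at h
  ext
  · simp only [frame, go, side, Prod.fst_zero, Prod.snd_zero, sub_zero]
    linear_combination z.1 * h
  · simp only [frame, go, side, Prod.fst_zero, Prod.snd_zero, sub_zero]
    linear_combination z.2 * h

/-- The affine automorphism of the lattice that a unimodular frame defines. -/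
theorem exists_latticeMap_eq_frame {e f : ℤ × ℤ} (h : side 0 e f = 1 ∨ side 0 e f = -1)
    (b : ℤ × ℤ) : ∃ (A : GL (Fin 2) ℤ) (t : Fin 2 → ℤ),
      ∀ z, latticeMap A t (toR z) = toR (frame b e f z) := by
  have hdet : IsUnit (!![e.1, f.1; e.2, f.2] : Matrix (Fin 2) (Fin 2) ℤ).det := by
    rw [Matrix.det_fin_two_of, Int.isUnit_iff]
    simp only [side, Prod.fst_zero, Prod.snd_zero, sub_zero] at h
    rcases h with h | h
    · left; linarith
    · right; linarith
  refine ⟨Matrix.GeneralLinearGroup.mk'' _ hdet, ![b.1, b.2], fun z => ?_⟩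
  ext i
  fin_cases i <;>
    simp [latticeMap, Matrix.GeneralLinearGroup.mk'', Matrix.nonsingInvUnit, toReal, frame, go] <;>
    ring

theorem latticeMap_eq_affine {d : ℕ} (A : GL (Fin d) ℤ) (t : Fin d → ℤ) :
    ∃ f : (Fin d → ℝ) ≃ᵃ[ℝ] (Fin d → ℝ), ⇑f = latticeMap A t := by
  let g : (Fin d → ℝ) →ᵃ[ℝ] (Fin d → ℝ) :=
    (Matrix.mulVecLin ((A : Matrix (Fin d) (Fin d) ℤ).map (Int.cast : ℤ → ℝ))).toAffineMap +
      AffineMap.const ℝ _ (toReal t)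
  have hg : ∀ x, g x = latticeMap A t x := fun x => by simp [g, latticeMap]
  have hbij : Function.Bijective g := by
    have h1 : ∀ x, latticeMap A⁻¹ (-((A⁻¹ : GL (Fin d) ℤ) : Matrix (Fin d) (Fin d) ℤ).mulVec t)
        (latticeMap A t x) = x := by
      intro x
      rw [latticeMap_latticeMap]
      simp [latticeMap_one_zero]
    have h2 : ∀ x, latticeMap A t (latticeMap A⁻¹
        (-((A⁻¹ : GL (Fin d) ℤ) : Matrix (Fin d) (Fin d) ℤ).mulVec t) x) = x := by
      intro x
      rw [latticeMap_latticeMap]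
      simp [latticeMap_one_zero, Matrix.mulVec_neg]
    exact Function.bijective_iff_has_inverse.2
      ⟨latticeMap A⁻¹ (-((A⁻¹ : GL (Fin d) ℤ) : Matrix (Fin d) (Fin d) ℤ).mulVec t),
        fun x => by rw [hg, h1], fun x => by rw [hg, h2]⟩
  exact ⟨AffineEquiv.ofBijective hbij, funext hg⟩

theorem latticeIso_polygon_map_frame {e f : ℤ × ℤ} (h : side 0 e f = 1 ∨ side 0 e f = -1)
    (b : ℤ × ℤ) (V : List (ℤ × ℤ)) : LatticeIso (polygon V) (polygon (V.map (frame b e f))) := by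
  obtain ⟨A, t, hA⟩ := exists_latticeMap_eq_frame h b
  refine ⟨A, t, ?_⟩
  obtain ⟨g, hg⟩ := latticeMap_eq_affine A t
  rw [polygon, polygon, ← hg, ← AffineEquiv.coe_toAffineMap, AffineMap.image_convexHull]
  congr 1
  rw [AffineEquiv.coe_toAffineMap, hg, Set.image_image]
  simp only [hA]
  refine Set.Subset.antisymm ?_ ?_
  · rintro _ ⟨z, hz, rfl⟩
    exact ⟨_, List.mem_map_of_mem hz, rfl⟩
  · rintro _ ⟨_, hz, rfl⟩
    obtain ⟨z, hzV, rfl⟩ := List.mem_map.1 hz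
    exact ⟨z, hzV, rfl⟩

theorem Trail.map_frame {P : Set (Fin 2 → ℝ)} {b e f : ℤ × ℤ} {L : List (ℤ × ℤ)} {w : ℤ × ℤ}
    (hef : side 0 e f = 1)
    (h : Trail (fun v u l => IsEdge P (frame b e f v) (frame 0 e f u) l) 0 L w) :
    Trail (IsEdge P) b (L.map (frame b e f)) (frame b e f w) := by
  have hb : frame b e f 0 = b := by simp [frame, go]
  induction h with
  | single u l h =>
    rw [frame_go]
    simp only [hb] at h ⊢
    simpa [hb] using Trail.single _ _ h
  | cons L w u l hL hw h ih =>
    rw [frame_go]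
    refine .cons _ _ _ _ ih ?_ h
    rwa [List.mem_map_of_injective (frame_injective (.inl hef) b)]

theorem IsSmooth.convex {P : Set (Fin 2 → ℝ)} (hP : IsSmooth P) : Convex ℝ P := by
  obtain ⟨S, -, rfl⟩ := hP.isPolytope
  exact convex_convexHull ℝ S

theorem length_le_of_latticePoints {P : Set (Fin 2 → ℝ)} {N : ℕ}
    (hN : (latticePoints P).encard ≤ N) {L : List (ℤ × ℤ)} (hn : L.Nodup)
    (hL : ∀ p ∈ L, toR p ∈ P) : L.length ≤ N := by
  have hinj : Function.Injective fun z : ℤ × ℤ => (![z.1, z.2] : Fin 2 → ℤ) := by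
    intro a b h
    exact Prod.ext (congrFun h 0) (congrFun h 1)
  have hsub : ((fun z : ℤ × ℤ => (![z.1, z.2] : Fin 2 → ℤ)) '' {z | z ∈ L}) ⊆
      latticePoints P := by
    rintro _ ⟨z, hz, rfl⟩
    exact hL z hz
  have h1 := (Set.encard_le_encard hsub).trans hN
  rw [hinj.encard_image, ← List.coe_toFinset, Set.encard_coe_eq_coe_finsetCard,
    List.toFinset_card_of_nodup hn] at h1
  exact_mod_cast h1

theorem IsEdge.lt_of_latticePoints {P : Set (Fin 2 → ℝ)} (hP : Convex ℝ P) {N : ℕ}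
    (hN : (latticePoints P).encard ≤ N) {v u : ℤ × ℤ} {l : ℕ} (h : IsEdge P v u l) : l < N := by
  have := length_le_of_latticePoints hN (nodup_points v l h.ne_zero) ?_
  · rw [length_points] at this; omega
  · intro q hq
    simp only [points, List.mem_map, List.mem_range] at hq
    obtain ⟨j, hj, rfl⟩ := hq
    exact hP.segment_subset h.start_mem.1 h.end_mem.1
      (toR_go_mem_segment v u (by omega))

theorem IsSmooth.exists_vertex {P : Set (Fin 2 → ℝ)} (hP : IsSmooth P) :
    ∃ v, toR v ∈ vertices P := by
  obtain ⟨S, hS, rfl⟩ := hP.isPolytope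
  have hne : (convexHull ℝ S).Nonempty := by
    rw [← affineSpan_nonempty ℝ, hP.isFullDimensional]
    exact Set.univ_nonempty
  obtain ⟨x, hx⟩ := (hS.isCompact_convexHull ℝ).extremePoints_nonempty hne
  obtain ⟨z, rfl⟩ := hP.isLattice x hx
  obtain ⟨p, rfl⟩ := exists_toR z
  exact ⟨p, hx⟩

/-- The coordinates with respect to a unimodular frame turn the lattice points and edges of a smooth
polygon into a model for the search. -/
theorem IsSmooth.edgeModel {P : Set (Fin 2 → ℝ)} (hP : IsSmooth P)
    (hN : (latticePoints P).encard ≤ (12 : ℕ)) {b e f : ℤ × ℤ} (hef : side 0 e f = 1) {m : ℕ}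
    (hm : ∀ v a la u l, IsEdge P (go v (-(la : ℕ)) a) a la → IsEdge P v u l →
      side 0 a u = 1 → l ≤ m) :
    EdgeModel m (fun z => toR (frame b e f z) ∈ P)
      (fun v u l => IsEdge P (frame b e f v) (frame 0 e f u) l) where
  convex p u r j hp hr hj := by
    rw [frame_go] at hr ⊢
    exact hP.convex.segment_subset hp hr (toR_go_mem_segment _ _ hj)
  length_le L hL hM := by
    have := length_le_of_latticePoints hN (hL.map (frame_injective (.inl hef) b)) (fun q hq => by
      obtain ⟨z, hz, rfl⟩ := List.mem_map.1 hq; exact hM z hz)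
    simpa using this
  one_le _ _ _ h := h.one_le
  mem_start _ _ _ h := h.start_mem.1
  mem_end v u l h := by rw [frame_go]; exact h.end_mem.1
  side_nonneg v u l p h hp := by
    have := h.side_nonneg hp
    rwa [side_frame hef] at this
  start_unique v u l v' u' l' h h' hq := by
    refine frame_injective (.inl hef) b (h.start_unique h' ?_)
    rw [← frame_go, ← frame_go, hq]
  next v u l h := by
    obtain ⟨a, la, c, lc, ha, hc, hac⟩ := hP.exists_corner h.end_mem
    have hback : ∀ q : ℤ × ℤ, go (go q (-(la : ℤ)) a) la a = q := fun q => by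
      ext <;> simp [go]
    have hs := h.start_unique ha (hback _).symm
    rw [← hs] at ha
    have hq : go (frame b e f v) l (frame 0 e f u) = go (frame b e f v) la a := by
      conv_rhs => rw [hs, hback]
    obtain rfl := h.direction_unique ha hq
    obtain ⟨u', rfl⟩ := exists_frame_eq hef c
    rw [side_frame_zero hef] at hac
    rw [← frame_go] at hc
    refine ⟨u', lc, hc, hac, hm _ (frame 0 e f u) la _ _ ?_ hc ?_⟩
    · rw [frame_go, hq]
      have : go (go (frame b e f v) la (frame 0 e f u)) (-(la : ℤ)) (frame 0 e f u) =
        frame b e f v := by ext <;> simp [go]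
      rwa [this]
    · rwa [side_frame_zero hef]

/-- The origin is placed at a corner whose outgoing edge is as long as possible, with that edge and
the reversed incoming edge along the axes. -/
theorem IsSmooth.exists_latticeIso {P : Set (Fin 2 → ℝ)} (hP : IsSmooth P)
    (hN : (latticePoints P).encard ≤ (12 : ℕ)) :
    ∃ V ∈ catalog ++ duplicates, LatticeIso (polygon V) P := by
  classical
  -- `C l`: some corner has an outgoing edge of length `l`
  let C : ℕ → Prop := fun l => ∃ v a la u, IsEdge P (go v (-(la : ℕ)) a) a la ∧
    IsEdge P v u l ∧ side 0 a u = 1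
  have hC : ∃ l, C l := by
    obtain ⟨v, hv⟩ := hP.exists_vertex
    obtain ⟨a, la, u, l, h⟩ := hP.exists_corner hv
    exact ⟨l, v, a, la, u, h⟩
  have hbd : ∀ l, C l → l ≤ 12 := by
    rintro l ⟨v, a, la, u, -, h, -⟩
    exact (h.lt_of_latticePoints hP.convex hN).le
  obtain ⟨l, hl⟩ := hC
  obtain ⟨b, a, la, u, ha, hu, hau⟩ := Nat.findGreatest_spec (hbd l hl) hl
  set m := Nat.findGreatest C 12
  have hm : ∀ v a la u l, IsEdge P (go v (-(la : ℕ)) a) a la → IsEdge P v u l →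
      side 0 a u = 1 → l ≤ m := fun v a la u l h1 h2 h3 =>
    Nat.le_findGreatest (hbd l ⟨v, a, la, u, h1, h2, h3⟩) ⟨v, a, la, u, h1, h2, h3⟩
  have hef : side 0 u (-a) = 1 := by
    simp only [side, Prod.fst_zero, Prod.snd_zero, Prod.fst_neg, Prod.snd_neg] at hau ⊢
    linarith
  have hmod := hP.edgeModel hN (b := b) hef hm
  have hb : frame b u (-a) 0 = b := by simp [frame, go]
  have h_edge : IsEdge P (frame b u (-a) 0) (frame 0 u (-a) (1, 0)) m := by
    rw [hb]
    simpa [frame, go] using hu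
  have h_up : toR (frame b u (-a) (0, 1)) ∈ P := by
    have h1 := hP.convex.segment_subset ha.end_mem.1 ha.start_mem.1
    have hla := ha.one_le
    have h2 := toR_go_mem_segment (go b (-(la : ℕ)) a) a (r := la) (j := la - 1) (by omega)
    rw [segment_symm] at h2
    have h3 := h1 h2
    have h4 : go (go b (-(la : ℕ)) a) ((la - 1 : ℕ) : ℤ) a = frame b u (-a) (0, 1) := by
      rw [Nat.cast_sub hla]
      ext <;> simp [frame, go] <;> ring
    rwa [h4] at h3
  have h_right : ∀ p, toR (frame b u (-a) p) ∈ P → 0 ≤ p.1 := by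
    intro p hp
    have h1 := ha.side_nonneg hp
    have h2 : side (go b (-(la : ℕ)) a) a (frame b u (-a) p) = side 0 a u * p.1 := by
      simp [side, frame, go]; ring
    rwa [h2, hau, one_mul] at h1
  obtain ⟨L, hL, hLc⟩ := hmod.exists_closed_trail h_edge h_up h_right
  refine ⟨L.reverse, hLc, ?_⟩
  have h1 := hL.map_frame hef
  rw [hb] at h1
  rw [h1.eq_polygon hP.convex]
  have h2 := latticeIso_polygon_map_frame (.inl hef) b L
  have h3 : polygon L.reverse = polygon L := by simp [polygon]
  rwa [h3]

/-! ### A criterion for smoothness -/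

theorem cross_convexComb (c v x y : Fin 2 → ℝ) {s t : ℝ} (h : s + t = 1) :
    cross c (s • x + t • y - v) = s * cross c (x - v) + t * cross c (y - v) := by
  obtain rfl : t = 1 - s := by linarith
  simp [cross]; ring

theorem polygon_cross_nonneg {V : List (ℤ × ℤ)} {c v : Fin 2 → ℝ}
    (h : ∀ x ∈ V, 0 ≤ cross c (toR x - v)) {p : Fin 2 → ℝ} (hp : p ∈ polygon V) :
    0 ≤ cross c (p - v) := by
  refine convexHull_min (t := {p | 0 ≤ cross c (p - v)}) ?_ ?_ hp
  · rintro _ ⟨x, hx, rfl⟩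
    exact h x hx
  · intro x hx y hy s t hs ht hst
    simp only [Set.mem_ofPred_eq] at hx hy ⊢
    rw [cross_convexComb c v x y hst]
    positivity

theorem polygon_side_nonneg {V : List (ℤ × ℤ)} {v u : ℤ × ℤ} (h : ∀ x ∈ V, 0 ≤ side v u x)
    {p : ℤ × ℤ} (hp : toR p ∈ polygon V) : 0 ≤ side v u p := by
  have := polygon_cross_nonneg (c := toR u) (v := toR v) (fun x hx => by
    rw [cross_toR]; exact_mod_cast h x hx) hp
  rw [cross_toR] at this
  exact_mod_cast this

theorem cross_eq_zero_of_mem_segment {c v b p : Fin 2 → ℝ} (hc : cross c (b - v) = 0)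
    (hp : p ∈ segment ℝ v b) : cross c (p - v) = 0 := by
  rw [segment_eq_image'] at hp
  obtain ⟨s, -, rfl⟩ := hp
  rw [add_sub_cancel_left, cross_smul_right, hc, mul_zero]

section Face

variable {V : List (ℤ × ℤ)} {c : Fin 2 → ℝ} {v b : ℤ × ℤ}

/-- The set of the points with `cross c (p - v) > 0` together with the segment from `v` to `b` on
its boundary line is convex. -/
theorem polygon_pos_or_mem_segment (hc : cross c (toR b - toR v) = 0)
    (h : ∀ x ∈ V, x ≠ v → x ≠ b → 0 < cross c (toR x - toR v)) {p : Fin 2 → ℝ}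
    (hp : p ∈ polygon V) : 0 < cross c (p - toR v) ∨ p ∈ segment ℝ (toR v) (toR b) := by
  refine convexHull_min
    (t := {p | 0 < cross c (p - toR v) ∨ p ∈ segment ℝ (toR v) (toR b)}) ?_ ?_ hp
  · rintro _ ⟨x, hx, rfl⟩
    by_cases hxv : x = v
    · exact .inr (hxv ▸ left_mem_segment ℝ _ _)
    by_cases hxb : x = b
    · exact .inr (hxb ▸ right_mem_segment ℝ _ _)
    exact .inl (h x hx hxv hxb)
  · rw [convex_iff_forall_pos]
    intro x hx y hy s t hs ht hst
    simp only [Set.mem_ofPred_eq] at hx hy ⊢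
    rw [cross_convexComb c _ x y hst]
    rcases hx with hx | hx <;> rcases hy with hy | hy
    · left; positivity
    · left; rw [cross_eq_zero_of_mem_segment hc hy]; simp only [mul_zero, add_zero]; positivity
    · left; rw [cross_eq_zero_of_mem_segment hc hx]; simp only [mul_zero, zero_add]; positivity
    · exact .inr (convex_segment _ _ hx hy hs.le ht.le hst)

theorem polygon_isExposed (hc : cross c (toR b - toR v) = 0)
    (h : ∀ x ∈ V, x ≠ v → x ≠ b → 0 < cross c (toR x - toR v)) (hv : v ∈ V) (hb : b ∈ V) :
    IsExposed ℝ (polygon V) (segment ℝ (toR v) (toR b)) := by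
  intro _
  let f : StrongDual ℝ (Fin 2 → ℝ) :=
    c 1 • ContinuousLinearMap.proj 0 - c 0 • ContinuousLinearMap.proj 1
  have hf : ∀ p, f p = -cross c (p - toR v) + f (toR v) := by
    intro p; simp [f, cross]; ring
  have hvP : toR v ∈ polygon V := subset_convexHull ℝ _ ⟨v, hv, rfl⟩
  have hbP : toR b ∈ polygon V := subset_convexHull ℝ _ ⟨b, hb, rfl⟩
  refine ⟨f, Set.Subset.antisymm (fun x hx => ?_) (fun x hx => ?_)⟩
  · refine ⟨(convex_convexHull ℝ _).segment_subset hvP hbP hx, fun y hy => ?_⟩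
    rw [hf x, hf y, cross_eq_zero_of_mem_segment hc hx]
    rcases polygon_pos_or_mem_segment hc h hy with hy | hy
    · linarith
    · rw [cross_eq_zero_of_mem_segment hc hy]
  · rcases polygon_pos_or_mem_segment hc h hx.1 with h1 | h1
    · have := hx.2 _ hvP
      rw [hf x] at this
      linarith
    · exact h1

end Face

/-- The quotient of a lattice vector by the greatest common divisor of its coordinates. -/
def prim (z : ℤ × ℤ) : ℤ × ℤ := (z.1 / Int.gcd z.1 z.2, z.2 / Int.gcd z.1 z.2)

/-- The points of `V` have a unimodular corner at `v` with neighbors `a` and `b`: the other points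
lie strictly between the rays from `v` to `b` and to `a`. -/
structure IsCorner (V : List (ℤ × ℤ)) (v a b : ℤ × ℤ) : Prop where
  pos : 0 < side v (b - v) a
  right : ∀ x ∈ V, x ≠ v → x ≠ b → 0 < side v (b - v) x
  left : ∀ x ∈ V, x ≠ v → x ≠ a → side v (a - v) x < 0
  unimodular : side 0 (prim (b - v)) (prim (a - v)) = 1

theorem primitive_eq_prim (x y : ℤ) : primitive ![x, y] = ![(prim (x, y)).1, (prim (x, y)).2] := by
  have h : Finset.univ.gcd ![x, y] = (Int.gcd x y : ℤ) := by
    rw [Int.coe_gcd, show (Finset.univ : Finset (Fin 2)) = {0, 1} from rfl, Finset.gcd_insert,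
      Finset.gcd_singleton]
    rw [← Int.abs_eq_normalize, ← Int.coe_gcd, ← Int.coe_gcd]
    simp [Int.gcd, Int.natAbs_abs]
  funext i
  fin_cases i <;> simp [primitive, h, prim]

namespace IsCorner

variable {V : List (ℤ × ℤ)} {v a b : ℤ × ℤ}

theorem cross_pos (h : IsCorner V v a b) : 0 < cross (toR b - toR v) (toR a - toR v) := by
  have := h.pos
  have h1 : cross (toR b - toR v) (toR a - toR v) = side v (b - v) a := by simp [cross, side]
  rw [h1]; exact_mod_cast this

theorem right_pos (h : IsCorner V v a b) : ∀ x ∈ V, x ≠ v → x ≠ b →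
    0 < cross (toR b - toR v) (toR x - toR v) := by
  intro x hx h1 h2
  have := h.right x hx h1 h2
  have h1 : cross (toR b - toR v) (toR x - toR v) = side v (b - v) x := by simp [cross, side]
  rw [h1]; exact_mod_cast this

theorem left_pos (h : IsCorner V v a b) : ∀ x ∈ V, x ≠ v → x ≠ a →
    0 < cross (toR v - toR a) (toR x - toR v) := by
  intro x hx h1 h2
  have := h.left x hx h1 h2
  have h1 : cross (toR v - toR a) (toR x - toR v) = -side v (a - v) x := by
    simp [cross, side]; ring
  rw [h1]
  have : (side v (a - v) x : ℝ) < 0 := by exact_mod_cast this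
  linarith

theorem cross_self_right : cross (toR b - toR v) (toR b - toR v) = 0 := by
  simp [cross]; ring

theorem cross_self_left : cross (toR v - toR a) (toR a - toR v) = 0 := by
  simp [cross]; ring

theorem ne (h : IsCorner V v a b) : a ≠ v ∧ b ≠ v ∧ a ≠ b := by
  have h1 := h.pos
  refine ⟨?_, ?_, ?_⟩ <;> rintro rfl <;> simp [side] at h1
  apply absurd h1; simp [mul_comm]

theorem mem_vertices (h : IsCorner V v a b) (hv : v ∈ V) : toR v ∈ vertices (polygon V) := by
  have hpt : ∀ x ∈ segment ℝ (toR v) (toR b), x ∈ segment ℝ (toR v) (toR a) → x = toR v := by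
    intro x h1 h2
    have h3 := cross_eq_zero_of_mem_segment cross_self_left h2
    rw [segment_eq_image'] at h1
    obtain ⟨s, -, rfl⟩ := h1
    rw [add_sub_cancel_left, cross_smul_right] at h3
    have h4 : cross (toR v - toR a) (toR b - toR v) = cross (toR b - toR v) (toR a - toR v) := by
      simp only [cross, Pi.sub_apply]; ring
    rw [h4] at h3
    rw [(mul_eq_zero.1 h3).resolve_right h.cross_pos.ne']
    simp
  refine ⟨subset_convexHull ℝ _ ⟨v, hv, rfl⟩, ?_⟩
  have key : ∀ x ∈ polygon V, ∀ y ∈ polygon V, toR v ∈ openSegment ℝ x y → x = toR v := by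
    rintro x hx y hy ⟨s, t, hs, ht, hst, hvxy⟩
    have hseg : ∀ (c : Fin 2 → ℝ) (w : ℤ × ℤ), cross c (toR w - toR v) = 0 →
        (∀ x ∈ V, x ≠ v → x ≠ w → 0 < cross c (toR x - toR v)) →
        x ∈ segment ℝ (toR v) (toR w) := by
      intro c w hc hpos
      rcases polygon_pos_or_mem_segment hc hpos hx with h1 | h1
      · exfalso
        have h2 : 0 ≤ cross c (y - toR v) := by
          rcases polygon_pos_or_mem_segment hc hpos hy with h2 | h2
          · exact h2.le
          · exact (cross_eq_zero_of_mem_segment hc h2).ge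
        have h3 := cross_convexComb c (toR v) x y hst
        rw [hvxy, sub_self] at h3
        have h4 : cross c 0 = 0 := by simp [cross]
        rw [h4] at h3
        have := mul_pos hs h1
        have := mul_nonneg ht.le h2
        linarith
      · exact h1
    exact hpt x (hseg _ b cross_self_right h.right_pos) (hseg _ a cross_self_left h.left_pos)
  intro x hx y hy hxy
  exact key x hx y hy hxy

/-- The segment from `v` to a vertex `x` other than `a`, `b` is not exposed: `x - v` is a positive
combination of `a - v` and `b - v`, where an exposing functional would be negative. -/
theorem neighbors_eq (h : IsCorner V v a b) (hV : vertices (polygon V) = toR '' {z | z ∈ V})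
    (hv : v ∈ V) (ha : a ∈ V) (hb : b ∈ V) :
    neighbors (polygon V) (toR v) = {toR b, toR a} := by
  have hsub : ∀ z ∈ V, toR z ∈ vertices (polygon V) := fun z hz => hV ▸ ⟨z, hz, rfl⟩
  refine Set.Subset.antisymm ?_ ?_
  · rintro w ⟨hw, hwv, hexp⟩
    rw [hV] at hw
    obtain ⟨x, hx, rfl⟩ := hw
    have hxv : x ≠ v := fun h => hwv (by rw [h])
    by_contra hcon
    simp only [Set.mem_insert_iff, Set.mem_singleton_iff, not_or] at hcon
    have hxb : x ≠ b := fun h => hcon.1 (by rw [h])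
    have hxa : x ≠ a := fun h => hcon.2 (by rw [h])
    obtain ⟨f, hf⟩ := hexp ⟨_, left_mem_segment ℝ _ _⟩
    have hfv := left_mem_segment ℝ (toR v) (toR x)
    have hfx := right_mem_segment ℝ (toR v) (toR x)
    have hlt : ∀ z ∈ V, z ≠ v → z ≠ x → f (toR z - toR v) < 0 := by
      intro z hz hzv hzx
      rw [map_sub, sub_neg]
      rw [hf] at hfv
      refine lt_of_le_of_ne (hfv.2 _ (hsub z hz).1) fun he => ?_
      refine not_mem_segment_of_vertex (hsub z hz) (hsub v hv).1 (hsub x hx).1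
        (fun h => hzv (toR_injective h)) (fun h => hzx (toR_injective h)) ?_
      rw [hf]
      exact ⟨(hsub z hz).1, fun y hy => he ▸ hfv.2 y hy⟩
    have h1 := hlt b hb h.ne.2.1 hxb.symm
    have h2 := hlt a ha h.ne.1 hxa.symm
    have h3 : f (toR x - toR v) = 0 := by
      rw [hf] at hfv hfx
      rw [map_sub, sub_eq_zero]
      exact le_antisymm (hfv.2 _ (hsub x hx).1) (hfx.2 _ (hsub v hv).1)
    have h4 := congrArg f (cross_smul (toR b - toR v) (toR a - toR v) (toR x - toR v))
    simp only [map_add, map_smul, smul_eq_mul, h3, mul_zero] at h4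
    have h5 := h.right_pos x hx hxv hxb
    have h6 := h.left_pos x hx hxv hxa
    have h7 : cross (toR x - toR v) (toR a - toR v) = cross (toR v - toR a) (toR x - toR v) := by
      simp only [cross, Pi.sub_apply]; ring
    rw [h7] at h4
    have h8 := mul_neg_of_pos_of_neg h6 h1
    have h9 := mul_neg_of_pos_of_neg h5 h2
    linarith
  · have hexb := polygon_isExposed cross_self_right h.right_pos hv hb
    have hexa := polygon_isExposed cross_self_left h.left_pos hv ha
    rintro w (rfl | rfl)
    · exact ⟨hsub b hb, fun e => h.ne.2.1 (toR_injective e), hexb⟩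
    · exact ⟨hsub a ha, fun e => h.ne.1 (toR_injective e), hexa⟩

end IsCorner

theorem vertices_polygon {V : List (ℤ × ℤ)} (h : ∀ v ∈ V, ∃ a ∈ V, ∃ b ∈ V, IsCorner V v a b) :
    vertices (polygon V) = toR '' {z | z ∈ V} := by
  refine Set.Subset.antisymm extremePoints_convexHull_subset ?_
  rintro _ ⟨v, hv, rfl⟩
  obtain ⟨a, -, b, -, hc⟩ := h v hv
  exact hc.mem_vertices hv

theorem affineSpan_polygon {V : List (ℤ × ℤ)} {v a b : ℤ × ℤ} (h : IsCorner V v a b)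
    (hv : v ∈ V) (ha : a ∈ V) (hb : b ∈ V) : affineSpan ℝ (polygon V) = ⊤ := by
  have hsub : ∀ z ∈ V, toR z ∈ affineSpan ℝ (polygon V) := fun z hz =>
    subset_affineSpan ℝ _ (subset_convexHull ℝ _ ⟨z, hz, rfl⟩)
  rw [← AffineSubspace.direction_eq_top_iff_of_nonempty ⟨_, hsub v hv⟩, eq_top_iff]
  intro x _
  have h1 := AffineSubspace.vsub_mem_direction (hsub a ha) (hsub v hv)
  have h2 := AffineSubspace.vsub_mem_direction (hsub b hb) (hsub v hv)
  rw [vsub_eq_sub] at h1 h2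
  have h3 := cross_smul (toR b - toR v) (toR a - toR v) x
  have h4 : x = (cross (toR b - toR v) (toR a - toR v))⁻¹ •
      (cross x (toR a - toR v) • (toR b - toR v) + cross (toR b - toR v) x • (toR a - toR v)) := by
    rw [← h3, inv_smul_smul₀ h.cross_pos.ne']
  rw [h4]
  exact Submodule.smul_mem _ _ (add_mem (Submodule.smul_mem _ _ h2) (Submodule.smul_mem _ _ h1))

theorem isSmooth_polygon {V : List (ℤ × ℤ)} (hne : V ≠ [])
    (h : ∀ v ∈ V, ∃ a ∈ V, ∃ b ∈ V, IsCorner V v a b) : IsSmooth (polygon V) := by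
  have hvert := vertices_polygon h
  refine ⟨⟨_, (List.finite_toSet V).image _, rfl⟩, ?_, ?_, ?_, ?_⟩
  · obtain ⟨v, hv⟩ := List.exists_mem_of_ne_nil V hne
    obtain ⟨a, ha, b, hb, hc⟩ := h v hv
    exact affineSpan_polygon hc hv ha hb
  · intro v hv
    rw [hvert] at hv
    obtain ⟨z, -, rfl⟩ := hv
    exact ⟨_, rfl⟩
  · intro v hv
    rw [hvert] at hv
    obtain ⟨v, hv, rfl⟩ := hv
    obtain ⟨a, ha, b, hb, hc⟩ := h v hv
    rw [hc.neighbors_eq hvert hv ha hb, Set.encard_pair]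
    · rfl
    · exact fun e => hc.ne.2.2 (toR_injective e).symm
  · intro v hv
    obtain ⟨v, rfl⟩ := exists_toR v
    change toR v ∈ _ at hv
    rw [hvert, toR_injective.mem_set_image] at hv
    obtain ⟨a, ha, b, hb, hc⟩ := h v hv
    refine ⟨![![b.1, b.2], ![a.1, a.2]], ?_, ?_, .inl ?_⟩
    · intro i j hij
      have hab : ![b.1, b.2] ≠ ![a.1, a.2] := by
        intro e
        exact hc.ne.2.2 (toR_injective (congrArg toReal e)).symm
      fin_cases i <;> fin_cases j <;> first | rfl | exact absurd hij hab | exact absurd hij.symm hab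
    · change _ = neighbors (polygon V) (toR v)
      rw [hc.neighbors_eq hvert hv ha hb]
      ext x
      simp [Fin.exists_fin_two, toR, eq_comm]
    · have hu := hc.unimodular
      have hsubs : ∀ w : ℤ × ℤ, ![w.1, w.2] - ![v.1, v.2] = ![(w - v).1, (w - v).2] := by
        intro w; ext i; fin_cases i <;> simp
      rw [Matrix.det_fin_two]
      simp only [Matrix.of_apply, Matrix.cons_val_zero, Matrix.cons_val_one, hsubs,
        primitive_eq_prim]
      simp only [side, Prod.fst_zero, Prod.snd_zero, sub_zero] at hu
      exact hu

/-! ### Properties of the catalog -/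

/-- The lattice points of the box `[0, 9] × [0, 4]`, which contains the polygons of the catalog. -/
def box : List (ℤ × ℤ) := ((List.range 10).product (List.range 5)).map fun z => (z.1, z.2)

/-- The points of the box on the left of all edges of the polygon with the vertices `V` in
counterclockwise order. -/
def boxPoints (V : List (ℤ × ℤ)) : List (ℤ × ℤ) :=
  box.filter fun z => (V.zip (V.rotate 1)).all fun e => decide (0 ≤ side e.1 (e.2 - e.1) z)

theorem mem_box {z : ℤ × ℤ} (h1 : 0 ≤ z.1) (h2 : z.1 ≤ 9) (h3 : 0 ≤ z.2) (h4 : z.2 ≤ 4) :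
    z ∈ box := by
  simp only [box, List.mem_map, Prod.exists, List.pair_mem_product, List.mem_range]
  exact ⟨z.1.toNat, z.2.toNat, ⟨by omega, by omega⟩, Prod.ext (by simp; omega) (by simp; omega)⟩

theorem encard_latticePoints_le {V : List (ℤ × ℤ)} {N : ℕ}
    (hbox : ∀ v ∈ V, 0 ≤ v.1 ∧ v.1 ≤ 9 ∧ 0 ≤ v.2 ∧ v.2 ≤ 4)
    (hV : ∀ e ∈ V.zip (V.rotate 1), ∀ x ∈ V, 0 ≤ side e.1 (e.2 - e.1) x)
    (hN : (boxPoints V).length ≤ N) : (latticePoints (polygon V)).encard ≤ N := by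
  have hsub : latticePoints (polygon V) ⊆
      (fun z : ℤ × ℤ => (![z.1, z.2] : Fin 2 → ℤ)) '' ↑(boxPoints V).toFinset := by
    intro z hz
    obtain ⟨z, rfl⟩ := exists_toR z
    replace hz : toR z ∈ polygon V := hz
    refine ⟨z, ?_, rfl⟩
    rw [Finset.mem_coe, List.mem_toFinset, boxPoints, List.mem_filter]
    constructor
    · have h1 := polygon_side_nonneg (v := (0, 0)) (u := (0, -1))
        (fun x hx => by have := hbox x hx; simp [side]; omega) hz
      have h2 := polygon_side_nonneg (v := (9, 0)) (u := (0, 1))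
        (fun x hx => by have := hbox x hx; simp [side]; omega) hz
      have h3 := polygon_side_nonneg (v := (0, 0)) (u := (1, 0))
        (fun x hx => by have := hbox x hx; simp [side]; omega) hz
      have h4 := polygon_side_nonneg (v := (0, 4)) (u := (-1, 0))
        (fun x hx => by have := hbox x hx; simp [side]; omega) hz
      simp [side] at h1 h2 h3 h4
      exact mem_box h1 h2 h3 h4
    · simp only [List.all_eq_true, decide_eq_true_eq]
      exact fun e he => polygon_side_nonneg (hV e he) hz
  refine (Set.encard_le_encard hsub).trans ((Set.encard_image_le _ _).trans ?_)
  rw [Set.encard_coe_eq_coe_finsetCard]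
  exact_mod_cast (List.toFinset_card_le _).trans hN

theorem catalog_box : ∀ V ∈ catalog, ∀ v ∈ V, 0 ≤ v.1 ∧ v.1 ≤ 9 ∧ 0 ≤ v.2 ∧ v.2 ≤ 4 := by
  decide +kernel

theorem catalog_sides : ∀ V ∈ catalog, ∀ e ∈ V.zip (V.rotate 1), ∀ x ∈ V,
    0 ≤ side e.1 (e.2 - e.1) x := by
  decide +kernel

theorem catalog_points : ∀ V ∈ catalog, (boxPoints V).length ≤ 12 := by
  decide +kernel

theorem isCorner_iff (V : List (ℤ × ℤ)) (v a b : ℤ × ℤ) : IsCorner V v a b ↔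
    0 < side v (b - v) a ∧ side 0 (prim (b - v)) (prim (a - v)) = 1 ∧
    (∀ x ∈ V, x ≠ v → x ≠ b → 0 < side v (b - v) x) ∧
    ∀ x ∈ V, x ≠ v → x ≠ a → side v (a - v) x < 0 :=
  ⟨fun h => ⟨h.pos, h.unimodular, h.right, h.left⟩, fun h => ⟨h.1, h.2.2.1, h.2.2.2, h.2.1⟩⟩

instance (V : List (ℤ × ℤ)) (v a b : ℤ × ℤ) : Decidable (IsCorner V v a b) :=
  decidable_of_iff _ (isCorner_iff V v a b).symm

theorem catalog_corners : ∀ V ∈ catalog, ∀ v ∈ V, ∃ a ∈ V, ∃ b ∈ V, IsCorner V v a b := by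
  decide +kernel

theorem catalog_nodup : ∀ V ∈ catalog, V ≠ [] ∧ V.Nodup := by
  decide +kernel

/-- The number of vertices and the sum of the cubes of the lattice lengths of the segments between
the vertices. The sum of the squares would not distinguish all polygons of the catalog. -/
def invariant (V : List (ℤ × ℤ)) : ℕ × ℕ :=
  (V.length, (V.map fun a => (V.map fun b => Int.gcd (a.1 - b.1) (a.2 - b.2) ^ 3).sum).sum)

theorem catalog_invariant : (catalog.map invariant).Nodup := by
  decide +kernel

/-! ### Counting the classes -/

theorem vertices_latticeMap {d : ℕ} (A : GL (Fin d) ℤ) (t : Fin d → ℤ) (P : Set (Fin d → ℝ)) :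
    vertices (latticeMap A t '' P) = latticeMap A t '' vertices P := by
  obtain ⟨f, hf⟩ := latticeMap_eq_affine A t
  rw [← hf]
  have hseg : ∀ x y, f '' openSegment ℝ x y = openSegment ℝ (f x) (f y) :=
    image_openSegment _ f.toAffineMap
  refine Set.Subset.antisymm ?_ ?_
  · rintro _ ⟨⟨a, ha, rfl⟩, h⟩
    refine ⟨a, ⟨ha, fun x hx y hy hxy => f.injective ?_⟩, rfl⟩
    refine h ⟨x, hx, rfl⟩ ⟨y, hy, rfl⟩ ?_
    rw [← hseg]
    exact ⟨a, hxy, rfl⟩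
  · rintro _ ⟨a, ⟨ha, h⟩, rfl⟩
    refine ⟨⟨a, ha, rfl⟩, ?_⟩
    rintro _ ⟨x, hx, rfl⟩ _ ⟨y, hy, rfl⟩ hxy
    rw [← hseg, f.injective.mem_set_image] at hxy
    rw [h hx hy hxy]

theorem LatticeIso.encard_vertices_eq {d : ℕ} {P Q : Set (Fin d → ℝ)} (h : LatticeIso P Q) :
    (vertices Q).encard = (vertices P).encard := by
  obtain ⟨A, t, rfl⟩ := h
  rw [vertices_latticeMap]
  obtain ⟨f, hf⟩ := latticeMap_eq_affine A t
  rw [← hf, f.injective.encard_image]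

theorem LatticeIso.exists_frame {P Q : Set (Fin 2 → ℝ)} (h : LatticeIso P Q) :
    ∃ b e f : ℤ × ℤ, (side 0 e f = 1 ∨ side 0 e f = -1) ∧
      ∀ S : Set (ℤ × ℤ), vertices P = toR '' S → vertices Q = toR '' (frame b e f '' S) := by
  obtain ⟨A, t, rfl⟩ := h
  refine ⟨(t 0, t 1), (A 0 0, A 1 0), (A 0 1, A 1 1), ?_, fun S hS => ?_⟩
  · have h := Matrix.isUnits_det_units A
    rw [Matrix.det_fin_two, Int.isUnit_iff] at h
    simp only [side, Prod.fst_zero, Prod.snd_zero, sub_zero]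
    rcases h with h | h
    · left; linarith
    · right; linarith
  · have h1 : ∀ z, latticeMap A t (toR z) =
        toR (frame (t 0, t 1) (A 0 0, A 1 0) (A 0 1, A 1 1) z) := by
      intro z
      ext i
      fin_cases i <;> simp [latticeMap, toReal, frame, go] <;> ring
    rw [vertices_latticeMap, hS, Set.image_image, Set.image_image]
    simp only [h1]

theorem invariant_map_frame {e f : ℤ × ℤ} (h : side 0 e f = 1 ∨ side 0 e f = -1) (b : ℤ × ℤ)
    (V : List (ℤ × ℤ)) : invariant (V.map (frame b e f)) = invariant V := by
  simp only [invariant, List.length_map, List.map_map, Function.comp_def, gcd_frame h]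

theorem invariant_perm {V W : List (ℤ × ℤ)} (h : V.Perm W) : invariant V = invariant W := by
  have h1 : ∀ g : ℤ × ℤ → ℕ, (V.map g).sum = (W.map g).sum := fun g => (h.map g).sum_eq
  simp only [invariant, h.length_eq, h1]

theorem invariant_eq_of_latticeIso {V W : List (ℤ × ℤ)} (hVn : V.Nodup) (hWn : W.Nodup)
    (hV : vertices (polygon V) = toR '' {z | z ∈ V})
    (hW : vertices (polygon W) = toR '' {z | z ∈ W}) (h : LatticeIso (polygon V) (polygon W)) :
    invariant V = invariant W := by
  obtain ⟨b, e, f, hef, hvert⟩ := h.exists_frame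
  have h1 := toR_injective.image_injective ((hvert _ hV).symm.trans hW)
  rw [← invariant_map_frame hef b V]
  refine invariant_perm ((List.perm_ext_iff_of_nodup (hVn.map (frame_injective hef b)) hWn).2 ?_)
  intro z
  have h2 := Set.ext_iff.1 h1 z
  simpa only [Set.mem_image, Set.mem_ofPred_eq, List.mem_map] using h2

theorem exists_catalog_of_mem_duplicates : ∀ V ∈ duplicates, ∃ W ∈ catalog,
    LatticeIso (polygon W) (polygon V) := by
  have key : ∀ V ∈ duplicates, ∃ W ∈ catalog, ∃ r ∈ [((2, 0), (0, 1), (-1, 0)),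
      ((3, 0), (-1, 0), (0, 1)), ((4, 0), (-1, 0), (-1, 1)), ((0, 1), (0, -1), (1, 1))],
      (side 0 r.2.1 r.2.2 = 1 ∨ side 0 r.2.1 r.2.2 = -1) ∧
      (W.map (frame r.1 r.2.1 r.2.2)).Perm V := by
    decide +kernel
  intro V hV
  obtain ⟨W, hW, r, -, hr, hp⟩ := key V hV
  refine ⟨W, hW, ?_⟩
  have h := latticeIso_polygon_map_frame hr r.1 W
  have h1 : polygon (W.map (frame r.1 r.2.1 r.2.2)) = polygon V := by
    simp only [polygon, hp.mem_iff]
  rwa [h1] at h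

theorem vertices_catalog {V : List (ℤ × ℤ)} (hV : V ∈ catalog) :
    vertices (polygon V) = toR '' {z | z ∈ V} := vertices_polygon (catalog_corners V hV)

theorem encard_vertices_catalog {V : List (ℤ × ℤ)} (hV : V ∈ catalog) :
    (vertices (polygon V)).encard = V.length := by
  rw [vertices_catalog hV, toR_injective.encard_image, ← List.coe_toFinset,
    Set.encard_coe_eq_coe_finsetCard, List.toFinset_card_of_nodup (catalog_nodup V hV).2]

theorem polygon_mem_smoothPolygons {V : List (ℤ × ℤ)} (hV : V ∈ catalog) :
    polygon V ∈ smoothPolygons 12 :=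
  ⟨isSmooth_polygon (catalog_nodup V hV).1 (catalog_corners V hV),
    encard_latticePoints_le (catalog_box V hV) (catalog_sides V hV) (catalog_points V hV)⟩

theorem exists_catalog_of_mem_smoothPolygons {P : Set (Fin 2 → ℝ)}
    (hP : P ∈ smoothPolygons 12) : ∃ V ∈ catalog, LatticeIso (polygon V) P := by
  obtain ⟨V, hV, h⟩ := hP.1.exists_latticeIso hP.2
  rcases List.mem_append.1 hV with hV | hV
  · exact ⟨V, hV, h⟩
  · obtain ⟨W, hW, h'⟩ := exists_catalog_of_mem_duplicates V hV
    exact ⟨W, hW, (latticeSetoid 2).iseqv.trans h' h⟩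

theorem injOn_catalog : Set.InjOn (fun V => Quotient.mk (latticeSetoid 2) (polygon V))
    {V | V ∈ catalog} := by
  intro V hV W hW h
  refine List.inj_on_of_nodup_map catalog_invariant hV hW ?_
  exact invariant_eq_of_latticeIso (catalog_nodup V hV).2 (catalog_nodup W hW).2
    (vertices_catalog hV) (vertices_catalog hW) (Quotient.exact h)

/-- The classes with a condition on the number of vertices correspond to the polygons of the catalog
with that condition. The condition is given as a predicate `p` and as a Boolean function `q`. -/
theorem numClasses_eq (p : ℕ∞ → Prop) (q : ℕ → Bool) (hpq : ∀ n : ℕ, p n ↔ q n = true) :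
    numClasses {P ∈ smoothPolygons 12 | p (vertices P).encard} =
      (catalog.filter fun V => q V.length).length := by
  have himage : Quotient.mk (latticeSetoid 2) ''
      {P ∈ smoothPolygons 12 | p (vertices P).encard} =
      (fun V => Quotient.mk (latticeSetoid 2) (polygon V)) ''
        {V | V ∈ catalog.filter fun V => q V.length} := by
    refine Set.Subset.antisymm ?_ ?_
    · rintro _ ⟨P, ⟨hP, hp⟩, rfl⟩
      obtain ⟨V, hV, h⟩ := exists_catalog_of_mem_smoothPolygons hP
      refine ⟨V, List.mem_filter.2 ⟨hV, ?_⟩, Quotient.sound h⟩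
      rwa [h.encard_vertices_eq, encard_vertices_catalog hV, hpq] at hp
    · rintro _ ⟨V, hV, rfl⟩
      obtain ⟨hV, hq⟩ := List.mem_filter.1 hV
      refine ⟨_, ⟨polygon_mem_smoothPolygons hV, ?_⟩, rfl⟩
      rwa [encard_vertices_catalog hV, hpq]
  have hn : (catalog.filter fun V => q V.length).Nodup :=
    (List.Nodup.of_map _ catalog_invariant).filter _
  have hsub : {V | V ∈ catalog.filter fun V => q V.length} ⊆ {V | V ∈ catalog} :=
    fun V hV => (List.mem_filter.1 hV).1
  rw [numClasses, himage, (injOn_catalog.mono hsub).encard_image,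
    ← List.coe_toFinset, Set.encard_coe_eq_coe_finsetCard, List.toFinset_card_of_nodup hn]

end LatticePolytope

theorem mainTheorem2 :
    LatticePolytope.numClasses (LatticePolytope.smoothPolygons 12) = 41 ∧
    LatticePolytope.numClasses {P ∈ LatticePolytope.smoothPolygons 12 |
      (LatticePolytope.vertices P).encard = 3} = 3 ∧
    LatticePolytope.numClasses {P ∈ LatticePolytope.smoothPolygons 12 |
      (LatticePolytope.vertices P).encard = 4} = 30 ∧
    LatticePolytope.numClasses {P ∈ LatticePolytope.smoothPolygons 12 |
      (LatticePolytope.vertices P).encard = 5} = 3 ∧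
    LatticePolytope.numClasses {P ∈ LatticePolytope.smoothPolygons 12 |
      (LatticePolytope.vertices P).encard = 6} = 4 ∧
    LatticePolytope.numClasses {P ∈ LatticePolytope.smoothPolygons 12 |
      (LatticePolytope.vertices P).encard = 7} = 0 ∧
    LatticePolytope.numClasses {P ∈ LatticePolytope.smoothPolygons 12 |
      (LatticePolytope.vertices P).encard = 8} = 1 ∧
    LatticePolytope.numClasses {P ∈ LatticePolytope.smoothPolygons 12 |
      9 ≤ (LatticePolytope.vertices P).encard} = 0 := by
  have hk : ∀ k : ℕ, LatticePolytope.numClasses {P ∈ LatticePolytope.smoothPolygons 12 |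
      (LatticePolytope.vertices P).encard = k} =
      (LatticePolytope.catalog.filter fun V => V.length == k).length := fun k =>
    LatticePolytope.numClasses_eq (· = k) (· == k) fun n => by simp
  refine ⟨?_, hk 3, hk 4, hk 5, hk 6, hk 7, hk 8, ?_⟩
  · have h := LatticePolytope.numClasses_eq (fun _ => True) (fun _ => true) fun n => by simp
    simp only [and_true] at h
    exact h
  · exact LatticePolytope.numClasses_eq (9 ≤ ·) (fun n => decide (9 ≤ n)) fun n => by
      rw [decide_eq_true_eq]; exact_mod_cast Iff.rfl
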